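/- Let $n\ge 2$ and let $\hat U=U\rtimes\mathbb C^*\le \mathrm{GL}(n)=\mathrm{GL}(n,\mathbb C)$ be a graded unipotent group generated along the first row: there are integers $1=\omega_1<\omega_2\le\cdots\le\omega_n$ and polynomials $p_{i,j}(\alpha_1,\dots,\alpha_n)$ with complex coefficients, with $p_{1,j}=\alpha_j$, $p_{i,i}=\alpha_1^{\omega_i}$ and $p_{i,j}=0$ for $i>j$, such that $\hat U$ is the subgroup $\{(p_{i,j}(\alpha))_{i,j}:\alpha\in\mathbb C^*\times\mathbb C^{n-1}\}$; its factor $\mathbb C^*$ consists of the matrices $\mathrm{diag}(t^{\omega_1},\dots,t^{\omega_n})$, and $U$ is given by $\alpha_1=1$. Put $|\omega|=\omega_1+\cdots+\omega_n$, $\mathrm{Sym}^\omega\mathbb C^n=\bigoplus_{i=1}^n\mathrm{Sym}^{\omega_i}\mathbb C^n$ and $\mathcal W=\wedge^n\mathrm{Sym}^\omega\mathbb C^n$. With $e_1,\dots,e_n$ the standard basis of $\mathbb C^n$, let $$\mathfrak p_n=\bigwedge_{j=1}^n\Big(\sum_{i=1}^{j}p_{i,j}(e_1,\dots,e_n)\Big)\in\mathcal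 W,\qquad p_{i,j}(e_1,\dots,e_n)\in \mathrm{Sym}^{\omega_i}\mathbb C^n \text{ (the $i$-th summand of } \mathrm{Sym}^\omega\mathbb C^n),$$ identify $\mathrm{GL}(n)/\hat U$ with the orbit $\mathrm{GL}(n)[\mathfrak p_n]\subset\mathbb P(\mathcal W)$, and let $\overline{\mathrm{GL}(n)/\hat U}$ be its closure in $\mathbb P(\mathcal W)$. Let $\omega_{\max-1}$ be the second largest weight (after $|\omega|$) of the central one-parameter subgroup $z\mapsto z\cdot 1$ of $\mathrm{GL}(n)$ on the linear span in $\mathcal W$ of the cone over $\overline{\mathrm{GL}(n)/\hat U}$. For an integer $\chi$ and a positive integer $p$, call $\chi/p$ *well adapted* if $$\omega_{\max-1}-n<\frac{\chi}{p\,|\omega|}<|\omega|-n .$$ Let $V$ be a finite-dimensional rational representation of $\mathrm{SL}(n)$ and let $X\subset\mathbb P(V)$ be an $\mathrm{SL}(n)$-invariant projective variety. Let $\mathbb C^*$ be the one-parameter subgroup $s(t)=\mathrm{diag}(t^{|\omega|-n\omega_1},\dots,t^{|\omega|-n\omega_n})$ of $\tilde U=\mathrm{SL}(n)\cap\hat U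 Z(\mathrm{GL}(n))$. The group $\mathrm{SL}(n)\times\mathbb C^*$ acts linearly on $\mathcal W$, $V$ and $\mathbb C^2$ as follows: $\mathrm{SL}(n)$ acts naturally on $\mathcal W$ and $V$ and trivially on $\mathbb C^2$; $t\in\mathbb C^*$ acts on $\mathcal W$ by right multiplication $g\mathfrak p_n\mapsto g\,s(t)\mathfrak p_n$, that is, with weight $(k_1\omega_1+\cdots+k_n\omega_n-n)|\omega|$ on the summand $\bigotimes_i\wedge^{k_i}\mathrm{Sym}^{\omega_i}\mathbb C^n$, trivially on $V$, and by $(x_0,x_1)\mapsto(t^{-1}x_0,x_1)$ on $\mathbb C^2$. Let $L^{(p,q)}_\chi$ be the linearisation on $\mathcal O_{\mathbb P(\mathcal W)}(p)\otimes\mathcal O_{\mathbb P(V)}(q)$, and $L^{(p,q,r)}_\chi$ that on $\mathcal O_{\mathbb P(\mathcal W)}(p)\otimes\mathcal O_{\mathbb P(V)}(q)\otimes\mathcal O_{\mathbb P^1}(r)$, obtained by twisting the induced linear action by $t^{-\chi}$, so that weights $\varepsilon$ of $\mathbb C^*$ become $\varepsilon-\chi$. A point is *unstable* if it is not semistable,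 i.e. if every invariant section of every positive tensor power of the linearised line bundle vanishes there. Put $\infty=[1:0]$ and $\mathbb C=\mathbb P^1\setminus\{\infty\}$. Then: 1. There is a constant $C$, depending only on $\hat U$, $V$ and $X$, such that for all positive integers $p,q$ with $p>Cq$ and all integers $\chi$ with $\chi/p$ well adapted, every point of the boundary $\big(\overline{\mathrm{GL}(n)/\hat U}\times X\big)\setminus\big(\mathrm{GL}(n)/\hat U\times X\big)$ of $\overline{\mathrm{GL}(n)/\hat U}\times X\subset\mathbb P(\mathcal W)\times X$ is unstable for the action of $\mathrm{SL}(n)\times\mathbb C^*$ on $\overline{\mathrm{GL}(n)/\hat U}\times X$ with respect to $L^{(p,q)}_\chi$. 2. There is a constant $C$, depending only on the same data, such that for all positive integers $p,q,r$ with $p>Cq$ and $r>Cq$ and all integers $\chi$ with $\chi/p$ well adapted, every point of the boundary $\big(\overline{\mathrm{GL}(n)/\hat U}\times X\times\mathbb P^1\big)\setminus\big(\mathrm{GL}(n)/\hat U\times X\times\mathbb C\big)$ is unstable for the action of $\mathrm{SL}(n)\times\mathbb C^*$ on $\overline{\mathrm{GL}(n)/\hat U}\times X\times\mathbb P^1$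 with respect to $L^{(p,q,r)}_\chi$. -/

import Mathlib

open scoped LinearAlgebra.Projectivization MatrixGroups
open MvPolynomial Matrix

noncomputable section

namespace GradedGIT

/-! ### Projective geometry: polynomial functions, Zariski closure -/

/-- Polynomial functions on a complex vector space: the algebra of functions generated by the
linear forms. -/
def IsPolyFun {E : Type*} [AddCommGroup E] [Module ℂ E] (f : E → ℂ) : Prop :=
  f ∈ Algebra.adjoin ℂ {h : E → ℂ | ∃ l : Module.Dual ℂ E, ∀ v, h v = l v}

/-- The Zariski closure of a set of points of `ℙ(E)`: the common zeros of all homogeneous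
polynomial functions vanishing on the set. -/
def zariskiClosure {E : Type*} [AddCommGroup E] [Module ℂ E] (S : Set (ℙ ℂ E)) :
    Set (ℙ ℂ E) :=
  {x | ∀ (d : ℕ) (f : E → ℂ), IsPolyFun f → (∀ (c : ℂ) (v : E), f (c • v) = c ^ d * f v) →
    (∀ s ∈ S, f s.rep = 0) → f x.rep = 0}

/-- Zariski closed subsets of `ℙ(E)`, that is, (possibly reducible or singular) projective
varieties embedded in `ℙ(E)`. -/
def IsZariskiClosed {E : Type*} [AddCommGroup E] [Module ℂ E] (S : Set (ℙ ℂ E)) : Prop :=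
  zariskiClosure S ⊆ S

/-- The action on `ℙ(E)` of a group element acting linearly on `E`. -/
def projAct {G E : Type*} [Group G] [AddCommGroup E] [Module ℂ E] (σ : Representation ℂ G E)
    (g : G) : ℙ ℂ E → ℙ ℂ E :=
  Projectivization.map (σ g) (σ.apply_bijective g).injective

/-- A representation of `SL(n)` is algebraic (rational) if its matrix coefficients are polynomials
in the entries of the group element. -/
def IsAlgebraicRep {n : ℕ} {V : Type*} [AddCommGroup V] [Module ℂ V]
    (ρ : Representation ℂ SL(n, ℂ) V) : Prop :=
  ∀ (v : V) (l : Module.Dual ℂ V), ∃ P : MvPolynomial (Fin n × Fin n) ℂ,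
    ∀ g : SL(n, ℂ), l (ρ g v) = eval (fun ij => g ij.1 ij.2) P

/-! ### Semistability for multiprojective varieties -/

/-- Semistability of a point `x` of an invariant closed subvariety `Y` of `ℙ(E) × ℙ(F)` for the
group `G` acting linearly on `E` and `F`, with respect to the line bundle `𝒪(p) ⊗ 𝒪(q)` whose
natural linearisation is twisted by the inverse of the character `θ` (so that an eigenvector of
weight `ε` on the fibres acquires the weight `ε - θ`): for some `m > 0` there is an invariant
section of the `m`-th power of the line bundle over `Y`, given by a polynomial function of
bidegree `(mp, mq)`, not vanishing at `x`. Only the restriction to `Y` is required to be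
invariant. (Every section over `Y` of a large enough power is given by a polynomial function, and
invariant sections may be replaced by their powers.) -/
def IsSemistable₂ {G E F : Type*} [Group G] [AddCommGroup E] [Module ℂ E]
    [AddCommGroup F] [Module ℂ F] (σ : Representation ℂ G E) (τ : Representation ℂ G F)
    (p q : ℕ) (θ : G →* ℂˣ) (Y : Set (ℙ ℂ E × ℙ ℂ F)) (x : ℙ ℂ E × ℙ ℂ F) : Prop :=
  ∃ (m : ℕ) (f : E × F → ℂ), 0 < m ∧ IsPolyFun f ∧
    (∀ (a b : ℂ) (u : E) (v : F),
      f (a • u, b • v) = a ^ (m * p) * b ^ (m * q) * f (u, v)) ∧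
    (∀ g : G, ∀ y ∈ Y,
      f (σ g y.1.rep, τ g y.2.rep) = ((θ g : ℂˣ) : ℂ) ^ m * f (y.1.rep, y.2.rep)) ∧
    f (x.1.rep, x.2.rep) ≠ 0

/-- Semistability of a point `x` of an invariant closed subvariety `Y` of
`ℙ(E) × ℙ(F) × ℙ(H)` with respect to `𝒪(p) ⊗ 𝒪(q) ⊗ 𝒪(r)`, with the natural linearisation twisted
by the inverse of the character `θ`. -/
def IsSemistable₃ {G E F H : Type*} [Group G] [AddCommGroup E] [Module ℂ E]
    [AddCommGroup F] [Module ℂ F] [AddCommGroup H] [Module ℂ H]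
    (σ : Representation ℂ G E) (τ : Representation ℂ G F) (υ : Representation ℂ G H)
    (p q r : ℕ) (θ : G →* ℂˣ) (Y : Set (ℙ ℂ E × ℙ ℂ F × ℙ ℂ H))
    (x : ℙ ℂ E × ℙ ℂ F × ℙ ℂ H) : Prop :=
  ∃ (m : ℕ) (f : E × F × H → ℂ), 0 < m ∧ IsPolyFun f ∧
    (∀ (a b c : ℂ) (u : E) (v : F) (w : H),
      f (a • u, b • v, c • w) = a ^ (m * p) * b ^ (m * q) * c ^ (m * r) * f (u, v, w)) ∧
    (∀ g : G, ∀ y ∈ Y,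
      f (σ g y.1.rep, τ g y.2.1.rep, υ g y.2.2.rep) =
        ((θ g : ℂˣ) : ℂ) ^ m * f (y.1.rep, y.2.1.rep, y.2.2.rep)) ∧
    f (x.1.rep, x.2.1.rep, x.2.2.rep) ≠ 0

/-! ### The `GL(n)`-modules `Sym^ω ℂⁿ` and `⋀ⁿ Sym^ω ℂⁿ`

The symmetric algebra of `ℂⁿ` is the polynomial ring `ℂ[e₁, …, eₙ]`, the variable `X j` being the
basis vector `e_j`; the symmetric power `Sym^k ℂⁿ` is its part of degree `k`. -/

/-- The symmetric power `Sym^k ℂⁿ`. -/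
abbrev SymPow (n k : ℕ) : Type := homogeneousSubmodule (Fin n) ℂ k

/-- `Sym^ω ℂⁿ`, the direct sum of the `Sym^{ω_i} ℂⁿ`, one summand for every index `i`. -/
abbrev SymW {n : ℕ} (ω : Fin n → ℕ) : Type := (i : Fin n) → SymPow n (ω i)

/-- `⋀ⁿ Sym^ω ℂⁿ`. -/
abbrev WedgeW {n : ℕ} (ω : Fin n → ℕ) : Type := ⋀[ℂ]^n (SymW ω)

/-- The action of a matrix on the symmetric algebra, `e_j ↦ A e_j = ∑ s, A s j • e_s`. -/
def symAlgMap {n : ℕ} (A : Matrix (Fin n) (Fin n) ℂ) :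
    MvPolynomial (Fin n) ℂ →ₐ[ℂ] MvPolynomial (Fin n) ℂ :=
  aeval fun j => ∑ s, A s j • (X s : MvPolynomial (Fin n) ℂ)

theorem symAlgMap_mem {n : ℕ} (A : Matrix (Fin n) (Fin n) ℂ) (k : ℕ)
    (f : MvPolynomial (Fin n) ℂ) (hf : f ∈ homogeneousSubmodule (Fin n) ℂ k) :
    symAlgMap A f ∈ homogeneousSubmodule (Fin n) ℂ k := by
  have h : (symAlgMap A f).IsHomogeneous (1 * k) := by
    refine MvPolynomial.IsHomogeneous.aeval hf _ fun j => ?_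
    refine (homogeneousSubmodule (Fin n) ℂ 1).sum_mem fun s _ => ?_
    exact (homogeneousSubmodule (Fin n) ℂ 1).smul_mem _ (isHomogeneous_X ℂ s)
  simpa using h

theorem symAlgMap_one {n : ℕ} :
    symAlgMap (1 : Matrix (Fin n) (Fin n) ℂ) = AlgHom.id ℂ _ := by
  ext1 j
  simp [symAlgMap, Matrix.one_apply]

theorem symAlgMap_mul {n : ℕ} (A B : Matrix (Fin n) (Fin n) ℂ) :
    symAlgMap (A * B) = (symAlgMap A).comp (symAlgMap B) := by
  ext1 j
  simp only [symAlgMap, aeval_X, AlgHom.comp_apply, map_sum, map_smul, Matrix.mul_apply,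
    Finset.sum_smul, Finset.smul_sum, smul_smul]
  rw [Finset.sum_comm]
  simp only [mul_comm]

/-- The induced action of a matrix on `Sym^ω ℂⁿ`. -/
def symWMap {n : ℕ} (ω : Fin n → ℕ) (A : Matrix (Fin n) (Fin n) ℂ) : SymW ω →ₗ[ℂ] SymW ω :=
  LinearMap.pi fun i =>
    ((symAlgMap A).toLinearMap.restrict (symAlgMap_mem A (ω i))) ∘ₗ LinearMap.proj i

theorem symWMap_one {n : ℕ} (ω : Fin n → ℕ) : symWMap ω 1 = LinearMap.id := by
  refine LinearMap.ext fun v => funext fun i => Subtype.ext ?_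
  simp [symWMap, symAlgMap_one]

theorem symWMap_mul {n : ℕ} (ω : Fin n → ℕ) (A B : Matrix (Fin n) (Fin n) ℂ) :
    symWMap ω (A * B) = symWMap ω A ∘ₗ symWMap ω B := by
  refine LinearMap.ext fun v => funext fun i => Subtype.ext ?_
  simp only [symWMap, symAlgMap_mul]
  rfl

/-- The action of `GL(n)` on `Sym^ω ℂⁿ`. -/
def symWRep {n : ℕ} (ω : Fin n → ℕ) : Representation ℂ (GL (Fin n) ℂ) (SymW ω) where
  toFun g := symWMap ω g
  map_one' := symWMap_one ω
  map_mul' g h := symWMap_mul ω g h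

/-- The exterior power of a representation. -/
def exteriorRep {G M : Type*} [Group G] [AddCommGroup M] [Module ℂ M] (n : ℕ)
    (σ : Representation ℂ G M) : Representation ℂ G (⋀[ℂ]^n M) where
  toFun g := exteriorPower.map n (σ g)
  map_one' := by
    rw [map_one, Module.End.one_eq_id, exteriorPower.map_id, Module.End.one_eq_id]
  map_mul' g h := by
    rw [map_mul, Module.End.mul_eq_comp, Module.End.mul_eq_comp, exteriorPower.map_comp]

/-- The action of `GL(n)` on `⋀ⁿ Sym^ω ℂⁿ`. -/
def wedgeRep {n : ℕ} (ω : Fin n → ℕ) : Representation ℂ (GL (Fin n) ℂ) (WedgeW ω) :=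
  exteriorRep n (symWRep ω)

/-! ### The remaining factors of `SL(n) × ℂˣ`-modules -/

/-- The action of `SL(n) × ℂˣ` on `ℂ²`, inducing the action on `ℙ¹`: `SL(n)` acts trivially, and
the one-parameter subgroup `s(t) = diag(t ^ (|ω| - n ω_i))` of `Ũ`, `|ω| = ω₁ + ⋯ + ω_n`, acts by
`[x₀ : x₁] ↦ [χ₀(s(t)) x₀ : x₁]`, where `χ₀` is the character of `Ũ` with kernel containing `U` and `χ₀(diag(t ^ (n ω_i - |ω|))) = t`, so that `χ₀(s(t)) = t⁻¹`. -/
def p1Rep (n : ℕ) : Representation ℂ (SL(n, ℂ) × ℂˣ) (Fin 2 → ℂ) where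
  toFun x := Matrix.toLin' (Matrix.diagonal ![((x.2⁻¹ : ℂˣ) : ℂ), 1])
  map_one' := by
    have h : (![1, 1] : Fin 2 → ℂ) = 1 := by ext i; fin_cases i <;> rfl
    simp [h, Module.End.one_eq_id]
  map_mul' x y := by
    refine LinearMap.ext fun v => funext fun i => ?_
    fin_cases i <;> simp [mul_assoc, mul_comm]

/-- The action of `SL(n) × ℂˣ` on the ambient space of `X`: the factor `ℂˣ` acts trivially. -/
def xRep {n : ℕ} {V : Type*} [AddCommGroup V] [Module ℂ V] (ρ : Representation ℂ SL(n, ℂ) V) :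
    Representation ℂ (SL(n, ℂ) × ℂˣ) V :=
  ρ.comp (MonoidHom.fst _ _)

/-- The character `(g, t) ↦ t ^ χ` by whose inverse the linearisation is twisted. -/
def twist (n : ℕ) (χ : ℤ) : SL(n, ℂ) × ℂˣ →* ℂˣ :=
  (zpowGroupHom χ).comp (MonoidHom.snd _ _)

/-- The open subset `ℂ` of `ℙ¹`, the complement of the point `∞ = [1 : 0]`. -/
def affineLine : Set (ℙ ℂ (Fin 2 → ℂ)) := {z | z.rep 1 ≠ 0}

/-! ### Graded unipotent groups generated along the first row -/

/-- A subgroup `Û = U ⋊ ℂˣ` of `GL(n)`, `n ≥ 2`, generated along the first row, with weights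
`1 = ω₁ < ω₂ ≤ ⋯ ≤ ω_n` and polynomials `p i j` in `α₁, …, α_n`: it consists of the upper triangular
matrices `(p i j (α))`, `α ∈ ℂˣ × ℂⁿ⁻¹`, with first row `α` and diagonal entries `α₁ ^ ω_i`, and its
factor `ℂˣ` is the group of diagonal matrices `diag(t ^ ω₁, …, t ^ ω_n)`. The unipotent radical `U`
is given by `α₁ = 1`, and the weights of `ℂˣ` on its Lie algebra are the `ω_j - 1 > 0`, `j ≥ 2`.
Indices are `0, …, n - 1` here. -/
structure FirstRowGroup (n : ℕ) [NeZero n] where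
  two_le : 2 ≤ n
  ω : Fin n → ℕ
  ω_zero : ω 0 = 1
  one_lt_ω : ∀ i, i ≠ 0 → 1 < ω i
  ω_mono : Monotone ω
  p : Fin n → Fin n → MvPolynomial (Fin n) ℂ
  p_first : ∀ j, p 0 j = X j
  p_diag : ∀ i, p i i = X 0 ^ ω i
  p_lower : ∀ i j, j < i → p i j = 0
  Uhat : Subgroup (GL (Fin n) ℂ)
  mem_Uhat : ∀ g : GL (Fin n) ℂ,
    g ∈ Uhat ↔ ∃ α : Fin n → ℂ, α 0 ≠ 0 ∧ ∀ i j, g i j = eval α (p i j)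
  torus_mem : ∀ (g : GL (Fin n) ℂ) (t : ℂ),
    (g : Matrix (Fin n) (Fin n) ℂ) = Matrix.diagonal (fun i => t ^ ω i) → g ∈ Uhat

namespace FirstRowGroup

variable {n : ℕ} [NeZero n] (D : FirstRowGroup n)

/-- The matrix `(p i j (α))`. -/
def rowMatrix (α : Fin n → ℂ) : Matrix (Fin n) (Fin n) ℂ := Matrix.of fun i j => eval α (D.p i j)

theorem det_rowMatrix (α : Fin n → ℂ) : (D.rowMatrix α).det = ∏ i, α 0 ^ D.ω i := by
  rw [Matrix.det_of_isUpperTriangular]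
  · simp [rowMatrix, D.p_diag]
  · intro i j hij
    have h : j < i := hij
    simp [rowMatrix, D.p_lower i j h]

theorem eval_scale (α : Fin n → ℂ) (hα : α 0 ≠ 0) (i j : Fin n) :
    eval (fun k => 2 * α k) (D.p i j) = 2 ^ D.ω i * eval α (D.p i j) := by
  have hdiag : (Matrix.diagonal fun i => (2 : ℂ) ^ D.ω i).det ≠ 0 := by
    rw [Matrix.det_diagonal]
    exact Finset.prod_ne_zero_iff.2 fun _ _ => pow_ne_zero _ two_ne_zero
  have hrow : (D.rowMatrix α).det ≠ 0 := by
    rw [det_rowMatrix]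
    exact Finset.prod_ne_zero_iff.2 fun _ _ => pow_ne_zero _ hα
  let a : GL (Fin n) ℂ := Matrix.GeneralLinearGroup.mkOfDetNeZero _ hdiag
  let b : GL (Fin n) ℂ := Matrix.GeneralLinearGroup.mkOfDetNeZero _ hrow
  have ha : a ∈ D.Uhat := D.torus_mem a 2 rfl
  have hb : b ∈ D.Uhat := (D.mem_Uhat b).2 ⟨α, hα, fun i j => rfl⟩
  obtain ⟨β, -, hβ⟩ := (D.mem_Uhat (a * b)).1 (D.Uhat.mul_mem ha hb)
  have hab : ∀ i j, (a * b) i j = 2 ^ D.ω i * eval α (D.p i j) := by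
    intro i j
    change ((Matrix.diagonal fun i => (2 : ℂ) ^ D.ω i) * D.rowMatrix α) i j = _
    rw [Matrix.diagonal_mul]; rfl
  have hβα : β = fun k => 2 * α k := by
    funext k
    have h := hβ 0 k
    rw [hab, D.p_first, D.ω_zero] at h
    simpa using h.symm
  rw [← hβα, ← hβ, hab]

/-- The polynomial `p i j` is homogeneous of degree `ω_i`, so that it has a value on vectors of
`ℂⁿ` in `Sym^{ω_i} ℂⁿ`. -/
theorem p_isHomogeneous (i j : Fin n) : (D.p i j).IsHomogeneous (D.ω i) := by
  have key : (X 0 : MvPolynomial (Fin n) ℂ) *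
      (aeval (fun k => C (2 : ℂ) * (X k : MvPolynomial (Fin n) ℂ)) (D.p i j)
        - C (2 ^ D.ω i) * D.p i j) = 0 := by
    refine MvPolynomial.funext fun α => ?_
    by_cases hα : α 0 = 0
    · simp [hα]
    · have h1 : eval α (aeval (fun k => C (2 : ℂ) * (X k : MvPolynomial (Fin n) ℂ)) (D.p i j))
          = eval (fun k => 2 * α k) (D.p i j) := by
        induction D.p i j using MvPolynomial.induction_on with
        | C a => simp
        | add p q hp hq => simp only [map_add, hp, hq]
        | mul_X p k hp => simp only [map_mul, hp, aeval_X, eval_C, eval_X]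
      simp only [map_mul, map_sub, eval_X, eval_C, map_zero, h1, D.eval_scale α hα]
      ring
  have key2 : aeval (fun k => C (2 : ℂ) * (X k : MvPolynomial (Fin n) ℂ)) (D.p i j)
      = C (2 ^ D.ω i) * D.p i j := by
    rcases mul_eq_zero.1 key with h | h
    · exact absurd h (X_ne_zero 0)
    · exact sub_eq_zero.1 h
  have hcoeff : ∀ (f : MvPolynomial (Fin n) ℂ) (d : Fin n →₀ ℕ),
      coeff d (aeval (fun k => C (2 : ℂ) * (X k : MvPolynomial (Fin n) ℂ)) f)
        = 2 ^ d.degree * coeff d f := by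
    intro f d
    induction f using MvPolynomial.induction_on' with
    | monomial e a =>
      have h : aeval (fun k => C (2 : ℂ) * (X k : MvPolynomial (Fin n) ℂ)) (monomial e a)
          = C (2 ^ e.degree) * monomial e a := by
        rw [aeval_monomial, monomial_eq]
        simp only [Finsupp.prod, mul_pow, Finset.prod_mul_distrib, Finset.prod_pow_eq_pow_sum,
          Finsupp.degree_apply, map_pow, MvPolynomial.algebraMap_eq]
        ring
      rw [h, coeff_C_mul, coeff_monomial]
      split_ifs with hd
      · rw [hd]
      · simp
    | add p q hp hq => simp only [map_add, coeff_add, hp, hq, mul_add]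
  intro d hd
  have h := hcoeff (D.p i j) d
  rw [key2, coeff_C_mul] at h
  have h2 : (2 : ℂ) ^ D.ω i = 2 ^ d.degree := mul_right_cancel₀ hd h
  have h3 : (2 : ℕ) ^ D.ω i = 2 ^ d.degree := by exact_mod_cast h2
  have h4 : D.ω i = d.degree := Nat.pow_right_injective le_rfl h3
  rw [h4, Finsupp.degree_eq_weight_one]; rfl

/-- `ω₁ + ⋯ + ω_n`. -/
def ωsum : ℕ := ∑ i, D.ω i

/-! ### The embedding of `GL(n)/Û` and its boundary -/

/-- The vector `𝔭_n = ⋀_j (∑_i p i j (e₁, …, e_n)) ∈ ⋀ⁿ Sym^ω ℂⁿ`, where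
`p i j (e₁, …, e_n) ∈ Sym^{ω_i} ℂⁿ` is placed in the `i`-th summand of `Sym^ω ℂⁿ`. As `e_j` is the
variable `X j` of the symmetric algebra, `p i j (e₁, …, e_n)` is the polynomial `p i j` itself. -/
def pn : WedgeW D.ω :=
  exteriorPower.ιMulti ℂ n fun j : Fin n => (fun i => ⟨D.p i j, D.p_isHomogeneous i j⟩ : SymW D.ω)

/-- `GL(n)/Û` embedded in `ℙ(⋀ⁿ Sym^ω ℂⁿ)`: the `GL(n)`-orbit of the point `[𝔭_n]`. -/
def orbit : Set (ℙ ℂ (WedgeW D.ω)) :=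
  {x | ∃ g : GL (Fin n) ℂ, x.submodule = ℂ ∙ (wedgeRep D.ω g D.pn)}

/-- The closure of `GL(n)/Û` in `ℙ(⋀ⁿ Sym^ω ℂⁿ)`. -/
def orbitClosure : Set (ℙ ℂ (WedgeW D.ω)) := zariskiClosure D.orbit

/-! ### Well adapted characters -/

/-- `m` is a weight of the central one-parameter subgroup of `GL(n)` on the closure of
`GL(n)/Û`, that is, on the linear span of the cone over it. -/
def IsCentralWeight (m : ℕ) : Prop :=
  ∃ w ∈ ⨆ x ∈ D.orbitClosure, x.submodule, w ≠ 0 ∧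
    ∀ z : ℂˣ, wedgeRep D.ω (Matrix.GeneralLinearGroup.scalar (Fin n) z) w = (z : ℂ) ^ m • w

/-- `ω_{max-1}`, the second highest weight; the highest one is `ω₁ + ⋯ + ω_n`. -/
def ωsecond : ℕ := sSup {m | D.IsCentralWeight m ∧ m < D.ωsum}

/-- The rational character `χ/p` is well adapted. -/
def WellAdapted (χ : ℤ) (p : ℕ) : Prop :=
  (D.ωsecond : ℚ) - n < (χ : ℚ) / ((p : ℚ) * D.ωsum) ∧
    (χ : ℚ) / ((p : ℚ) * D.ωsum) < (D.ωsum : ℚ) - n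

/-! ### The linear actions of `SL(n) × ℂˣ` -/

/-- The linear action of `SL(n) × ℂˣ` on `⋀ⁿ Sym^ω ℂⁿ`. Here `SL(n)` acts on the left, and `ℂˣ` is the
one-parameter subgroup `s(t) = diag(t ^ (|ω| - n ω₁), …, t ^ (|ω| - n ω_n))`, `|ω| = ω₁ + ⋯ + ω_n`, of
`Ũ = SL(n) ∩ Û Z(GL(n))`, acting on the right, `g 𝔭_n ↦ g s(t) 𝔭_n`. As `s(t)` is the product of the
scalar `t ^ |ω|` and the element `diag(t ^ (-n ω_i))` of `Û`, which multiplies `𝔭_n` by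
`t ^ (-n |ω|)`, this is the scalar matrix `t ^ |ω|` followed by multiplication by `t ^ (-n |ω|)`;
the weight on the summand `⨂_i ⋀^{k_i} Sym^{ω_i} ℂⁿ` is `(∑ k_i ω_i - n) |ω|`. -/
def wRep : Representation ℂ (SL(n, ℂ) × ℂˣ) (WedgeW D.ω) where
  toFun x := ((x.2 ^ (-((n * D.ωsum : ℕ) : ℤ)) : ℂˣ) : ℂ) •
    wedgeRep D.ω (Matrix.SpecialLinearGroup.toGL x.1 *
      Matrix.GeneralLinearGroup.scalar (Fin n) (x.2 ^ D.ωsum))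
  map_one' := by simp
  map_mul' x y := by
    have hc : Matrix.SpecialLinearGroup.toGL (x * y).1 *
        Matrix.GeneralLinearGroup.scalar (Fin n) ((x * y).2 ^ D.ωsum) =
        (Matrix.SpecialLinearGroup.toGL x.1 *
          Matrix.GeneralLinearGroup.scalar (Fin n) (x.2 ^ D.ωsum)) *
        (Matrix.SpecialLinearGroup.toGL y.1 *
          Matrix.GeneralLinearGroup.scalar (Fin n) (y.2 ^ D.ωsum)) := by
      have hs : Commute (Matrix.GeneralLinearGroup.scalar (Fin n) (x.2 ^ D.ωsum))
          (Matrix.SpecialLinearGroup.toGL y.1) :=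
        Units.ext (Matrix.scalar_commute _ (fun _ => Commute.all _ _) _)
      rw [Prod.fst_mul, Prod.snd_mul, map_mul, mul_pow, map_mul, mul_assoc, mul_assoc,
        ← mul_assoc (Matrix.GeneralLinearGroup.scalar (Fin n) (x.2 ^ D.ωsum)), hs.eq, mul_assoc]
    rw [hc, map_mul, Prod.snd_mul, mul_zpow, Units.val_mul, smul_mul_smul_comm]

/-- The closed subvariety `(GL(n)/Û)⁻ × X` of `ℙ(⋀ⁿ Sym^ω ℂⁿ) × X`, the closure of
`GL(n) ×_Û X ≅ GL(n)/Û × X`. -/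
def completion₂ {V : Type*} [AddCommGroup V] [Module ℂ V] (X : Set (ℙ ℂ V)) :
    Set (ℙ ℂ (WedgeW D.ω) × ℙ ℂ V) :=
  D.orbitClosure ×ˢ X

/-- Its boundary: the complement of `GL(n)/Û × X`. -/
def boundary₂ {V : Type*} [AddCommGroup V] [Module ℂ V] (X : Set (ℙ ℂ V)) :
    Set (ℙ ℂ (WedgeW D.ω) × ℙ ℂ V) :=
  D.completion₂ X \ D.orbit ×ˢ X

/-- The closed subvariety `(GL(n)/Û)⁻ × X × ℙ¹` of `ℙ(⋀ⁿ Sym^ω ℂⁿ) × X × ℙ¹`, the closure of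
`GL(n) ×_Û (X × ℂ) ≅ GL(n)/Û × X × ℂ`. -/
def completion₃ {V : Type*} [AddCommGroup V] [Module ℂ V] (X : Set (ℙ ℂ V)) :
    Set (ℙ ℂ (WedgeW D.ω) × ℙ ℂ V × ℙ ℂ (Fin 2 → ℂ)) :=
  D.orbitClosure ×ˢ X ×ˢ Set.univ

/-- Its boundary: the complement of `GL(n)/Û × X × ℂ`. -/
def boundary₃ {V : Type*} [AddCommGroup V] [Module ℂ V] (X : Set (ℙ ℂ V)) :
    Set (ℙ ℂ (WedgeW D.ω) × ℙ ℂ V × ℙ ℂ (Fin 2 → ℂ)) :=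
  D.completion₃ X \ D.orbit ×ˢ X ×ˢ affineLine

end FirstRowGroup

end GradedGIT

end

/-!
The proof is elementary: every boundary point is destabilised by an explicit one-parameter subgroup,
in the sense that an invariant section, evaluated along the orbit of the point under the subgroup,
is a polynomial in `t` with a positive order of vanishing at `t = 0` and at the same time a constant
(`eq_zero_of_pow_mul_eq`).

For `ξ ∈ ℂⁿ` let `y_ξ` (`evalForm`) be the linear form `u₁ ∧ ⋯ ∧ u_n ↦ det (u_{j,i}(ξ))` on
`⋀ⁿ Sym^ω ℂⁿ`. As `(p i j (α))` is triangular with diagonal entries `α₁ ^ ω_i`, one has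
`y_ξ (g 𝔭_n) = (ξ ⬝ᵥ g e₁) ^ |ω|`. Let `w` represent a point of the closure of `GL(n)/Û`.

* If `y_ξ w = 0` for all `ξ`, then `w` has no component of central weight `|ω|`. Indeed `w` is a linear
  combination of vectors `g 𝔭_n`; the component of weight `|ω|` of `g 𝔭_n` is
  `⋀_i (g e₁) ^ ω_i`, a homogeneous polynomial of degree `|ω|` in `g e₁`; and the powers of linear
  forms span all homogeneous polynomials. So the weights of `w` are at most `ω_{max-1}`
  (`exists_weight_decomposition`), and the factor `ℂˣ` destabilises by the lower bound on `χ / p`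
  (`eq_zero_of_evalForm_eq_zero`).
* If `y_ξ w ≠ 0` for some `ξ`, then `w` is a multiple of `A 𝔭_n` for some matrix `A`
  (`exists_rep_eq_of_evalForm_ne_zero`). On the orbit, `g` can be multiplied by an element of `Û` so that
  `ξ g = (1, 0, …, 0)`, and then the entries of `g` are themselves linear forms in `g 𝔭_n` (`chart`),
  so that `w` being of this form is a closed condition where `y_ξ ≠ 0`. If `A` is invertible, the
  point lies in the orbit. Otherwise the one-parameter subgroup of `SL(n)` acting by `t` on a
  hyperplane containing the image of `A` acts with positive weights on `A 𝔭_n`, and it destabilises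
  as soon as `p` is large compared to `q` (`eq_zero_of_det_eq_zero`).

On the remaining part of the boundary of the second completion, over `g 𝔭_n` in the orbit and
`∞ ∈ ℙ¹`, the subgroup `(g s(t) g⁻¹, t⁻¹)`, which fixes `g 𝔭_n`, destabilises for `r` large compared
to `q` (`eq_zero_of_mem_orbit`); this uses `χ ≥ 0`, which holds because `n` is a central weight less than
`|ω|` (`n_le_ωsecond`).
-/

noncomputable section

namespace GradedGIT

/-! ### Polynomial functions and polynomial maps -/

section PolynomialMaps

variable {E F M N : Type*} [AddCommGroup E] [Module ℂ E] [AddCommGroup F] [Module ℂ F]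
  [AddCommGroup M] [Module ℂ M] [AddCommGroup N] [Module ℂ N]

theorem IsPolyFun.linear (l : Module.Dual ℂ E) : IsPolyFun fun v => l v :=
  Algebra.subset_adjoin ⟨l, fun _ => rfl⟩

theorem IsPolyFun.const (c : ℂ) : IsPolyFun fun _ : E => c :=
  Subalgebra.algebraMap_mem _ c

theorem IsPolyFun.add {f g : E → ℂ} (hf : IsPolyFun f) (hg : IsPolyFun g) :
    IsPolyFun fun v => f v + g v :=
  Subalgebra.add_mem _ hf hg

theorem IsPolyFun.sub {f g : E → ℂ} (hf : IsPolyFun f) (hg : IsPolyFun g) :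
    IsPolyFun fun v => f v - g v :=
  Subalgebra.sub_mem _ hf hg

theorem IsPolyFun.mul {f g : E → ℂ} (hf : IsPolyFun f) (hg : IsPolyFun g) :
    IsPolyFun fun v => f v * g v :=
  Subalgebra.mul_mem _ hf hg

theorem IsPolyFun.pow {f : E → ℂ} (hf : IsPolyFun f) (k : ℕ) : IsPolyFun fun v => f v ^ k :=
  Subalgebra.pow_mem _ hf k

theorem IsPolyFun.sum {ι : Type*} {s : Finset ι} {f : ι → E → ℂ}
    (hf : ∀ i ∈ s, IsPolyFun (f i)) : IsPolyFun fun v => ∑ i ∈ s, f i v := by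
  have h := Subalgebra.sum_mem _ hf
  rwa [show (∑ i ∈ s, f i) = fun v => ∑ i ∈ s, f i v from funext fun v => by simp] at h

theorem IsPolyFun.prod {ι : Type*} {s : Finset ι} {f : ι → E → ℂ}
    (hf : ∀ i ∈ s, IsPolyFun (f i)) : IsPolyFun fun v => ∏ i ∈ s, f i v := by
  have h := Subalgebra.prod_mem _ hf
  rwa [show (∏ i ∈ s, f i) = fun v => ∏ i ∈ s, f i v from funext fun v => by simp] at h

theorem IsPolyFun.id : IsPolyFun fun t : ℂ => t :=
  IsPolyFun.linear LinearMap.id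

/-- A map between complex vector spaces is polynomial if its composition with every linear form
is a polynomial function. -/
def IsPolyMap (G : E → M) : Prop :=
  ∀ l : Module.Dual ℂ M, IsPolyFun fun v => l (G v)

theorem IsPolyFun.comp {f : M → ℂ} (hf : IsPolyFun f) {G : E → M} (hG : IsPolyMap G) :
    IsPolyFun fun v => f (G v) := by
  refine Algebra.adjoin_induction (p := fun f _ => IsPolyFun fun v => f (G v)) ?_ ?_ ?_ ?_ hf
  · rintro h ⟨l, hl⟩
    simpa only [hl] using hG l
  · exact fun c => IsPolyFun.const c
  · exact fun _ _ _ _ h₁ h₂ => h₁.add h₂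
  · exact fun _ _ _ _ h₁ h₂ => h₁.mul h₂

theorem IsPolyMap.const (m : M) : IsPolyMap fun _ : E => m := fun l => IsPolyFun.const (l m)

theorem IsPolyMap.smul {c : E → ℂ} {G : E → M} (hG : IsPolyMap G) (hc : IsPolyFun c) :
    IsPolyMap fun v => c v • G v := fun l => by
  simpa only [map_smul, smul_eq_mul] using hc.mul (hG l)

theorem IsPolyMap.sum {ι : Type*} {s : Finset ι} {G : ι → E → M}
    (hG : ∀ i ∈ s, IsPolyMap (G i)) : IsPolyMap fun v => ∑ i ∈ s, G i v := fun l => by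
  simpa only [map_sum] using IsPolyFun.sum fun i hi => hG i hi l

theorem IsPolyMap.prodMk {G : E → M} (hG : IsPolyMap G) {H : E → N} (hH : IsPolyMap H) :
    IsPolyMap fun v => (G v, H v) := fun l => by
  have h : ∀ v, l (G v, H v) = (l ∘ₗ LinearMap.inl ℂ M N) (G v) +
      (l ∘ₗ LinearMap.inr ℂ M N) (H v) := fun v => by simp [← map_add]
  simpa only [h] using (hG _).add (hH _)

theorem IsPolyMap.pi {ι : Type*} [Fintype ι] [DecidableEq ι] {P : ι → Type*}
    [∀ i, AddCommGroup (P i)] [∀ i, Module ℂ (P i)] {G : E → ∀ i, P i}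
    (hG : ∀ i, IsPolyMap fun v => G v i) : IsPolyMap G := fun l => by
  have h : ∀ v, l (G v) = ∑ i, (l ∘ₗ LinearMap.single ℂ P i) (G v i) := fun v => by
    simp only [LinearMap.comp_apply, ← map_sum]
    exact congrArg l (LinearMap.sum_single_apply P (G v)).symm
  simpa only [h] using IsPolyFun.sum fun i _ => hG i _

theorem IsPolyMap.multilinear {ι : Type*} [Fintype ι] [DecidableEq ι] [Module.Finite ℂ M]
    (Φ : MultilinearMap ℂ (fun _ : ι => M) N) {G : ι → E → M} (hG : ∀ j, IsPolyMap (G j)) :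
    IsPolyMap fun v => Φ fun j => G j v := by
  let b := Module.finBasis ℂ M
  have h : ∀ v, (Φ fun j => G j v) =
      ∑ r : ι → Fin (Module.finrank ℂ M), (∏ j, b.coord (r j) (G j v)) • Φ fun j => b (r j) := by
    intro v
    have h₁ : (fun j => G j v) = fun j => ∑ k, b.coord k (G j v) • b k :=
      funext fun j => (b.sum_repr (G j v)).symm
    rw [h₁, MultilinearMap.map_sum]
    exact Finset.sum_congr rfl fun r _ => Φ.map_smul_univ _ _
  simp only [h]
  exact IsPolyMap.sum fun r _ =>
    (IsPolyMap.const _).smul (IsPolyFun.prod fun j _ => hG j _)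

theorem IsPolyFun.continuous {f : ℂ → ℂ} (hf : IsPolyFun f) : Continuous f := by
  refine Algebra.adjoin_induction (p := fun f _ => Continuous f) ?_ ?_ ?_ ?_ hf
  · rintro h ⟨l, hl⟩
    rw [show h = l from funext hl]
    exact l.continuous_of_finiteDimensional
  · exact fun c => continuous_const
  · exact fun _ _ _ _ h₁ h₂ => h₁.add h₂
  · exact fun _ _ _ _ h₁ h₂ => h₁.mul h₂

/-- Two continuous functions of `t` that agree for `t ≠ 0` agree at `0`. -/
theorem eq_at_zero_of_forall_units {f g : ℂ → ℂ} (hf : Continuous f) (hg : Continuous g)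
    (h : ∀ t : ℂˣ, f t = g t) : f 0 = g 0 := by
  have hd : Dense {t : ℂ | t ≠ 0} := dense_compl_singleton 0
  exact congrFun (Continuous.ext_on hd hf hg fun t ht => h (Units.mk0 t ht)) 0

/-- The numerical content of the Hilbert–Mumford criterion: a polynomial function of positive order
of vanishing at `t = 0` that is constant for `t ≠ 0` vanishes. -/
theorem eq_zero_of_pow_mul_eq {h : ℂ → ℂ} (hh : IsPolyFun h) {k : ℕ} (hk : 0 < k) {c : ℂ}
    (H : ∀ t : ℂˣ, (t : ℂ) ^ k * h t = c) : c = 0 := by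
  have := eq_at_zero_of_forall_units (f := fun t => t ^ k * h t) (g := fun _ => c)
    ((IsPolyFun.id.pow k).mul hh).continuous continuous_const H
  simpa [hk.ne'] using this.symm

/-- The components of a polynomial in `t` with values in a subspace lie in that subspace. -/
theorem mem_of_forall_sum_pow_smul_mem {S : Submodule ℂ M} {k : ℕ} {Q : ℕ → M}
    (H : ∀ t : ℂˣ, ∑ m ∈ Finset.range k, (t : ℂ) ^ m • Q m ∈ S) {m : ℕ} (hm : m < k) :
    Q m ∈ S := by
  by_contra hQ
  obtain ⟨l, hl, hS⟩ := Submodule.exists_le_ker_of_notMem hQ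
  let P : Polynomial ℂ := ∑ i ∈ Finset.range k, Polynomial.monomial i (l (Q i))
  have hP : P = 0 := by
    refine Polynomial.eq_zero_of_infinite_isRoot P
      (Set.Infinite.mono (s := {0}ᶜ) (fun t ht => ?_) (Set.finite_singleton (0 : ℂ)).infinite_compl)
    obtain ⟨u, rfl⟩ : ∃ u : ℂˣ, (u : ℂ) = t := ⟨Units.mk0 t ht, rfl⟩
    simpa [P, Polynomial.eval_finsetSum, mul_comm] using hS (H u)
  have h : P.coeff m = l (Q m) := by
    simp [P, Polynomial.finsetSum_coeff, Polynomial.coeff_monomial, hm]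
  exact hl (by rw [← h, hP, Polynomial.coeff_zero])

/-- Families `g t` of elements of `SL(n)`, `t ∈ ℂˣ`, whose entries are Laurent polynomials with
poles of order at most `a` at `0`, act through `ρ` with poles of order at most `a * d`. -/
def HasPoleBound {n : ℕ} {V : Type*} [AddCommGroup V] [Module ℂ V]
    (ρ : Representation ℂ SL(n, ℂ) V) (d : ℕ) : Prop :=
  ∀ (a : ℕ) (g : ℂˣ → SL(n, ℂ)) (e : Fin n × Fin n → ℂ → ℂ),
    (∀ ij, IsPolyFun (e ij)) → (∀ (t : ℂˣ) ij, (t : ℂ) ^ a * g t ij.1 ij.2 = e ij t) →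
    ∀ v : V, ∃ γ : ℂ → V, IsPolyMap γ ∧ ∀ t : ℂˣ, γ t = (t : ℂ) ^ (a * d) • ρ (g t) v

/-- One may take for `d` a bound for the degrees of the polynomials giving the matrix coefficients
of the representation. -/
theorem IsAlgebraicRep.exists_hasPoleBound {n : ℕ} {V : Type*} [AddCommGroup V] [Module ℂ V]
    [FiniteDimensional ℂ V] {ρ : Representation ℂ SL(n, ℂ) V} (hρ : IsAlgebraicRep ρ) :
    ∃ d : ℕ, HasPoleBound ρ d := by
  let b := Module.finBasis ℂ V
  choose P hP using fun i j => hρ (b i) (b.coord j)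
  refine ⟨∑ i, ∑ j, (P i j).totalDegree, fun a g e he hge v => ?_⟩
  set d := ∑ i, ∑ j, (P i j).totalDegree with hd
  have hdeg : ∀ i j, ∀ s ∈ (P i j).support, s.degree ≤ d := by
    intro i j s hs
    refine (le_totalDegree hs).trans (le_trans ?_ (Finset.single_le_sum
      (f := fun i => ∑ j, (P i j).totalDegree) (fun _ _ => Nat.zero_le _) (Finset.mem_univ i)))
    exact Finset.single_le_sum (f := fun j => (P i j).totalDegree) (fun _ _ => Nat.zero_le _)
      (Finset.mem_univ j)
  let c : Fin (Module.finrank ℂ V) → Fin (Module.finrank ℂ V) → ℂ → ℂ := fun i j t =>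
    ∑ s ∈ (P i j).support, coeff s (P i j) * (t ^ (a * (d - s.degree)) * ∏ ij, e ij t ^ s ij)
  refine ⟨fun t => ∑ i, ∑ j, (b.coord i v * c i j t) • b j, ?_, fun t => ?_⟩
  · refine IsPolyMap.sum fun i _ => IsPolyMap.sum fun j _ => (IsPolyMap.const _).smul ?_
    exact (IsPolyFun.const _).mul (IsPolyFun.sum fun s _ => (IsPolyFun.const _).mul
      ((IsPolyFun.id.pow _).mul (IsPolyFun.prod fun ij _ => (he ij).pow _)))
  · have hc : ∀ i j, c i j t = (t : ℂ) ^ (a * d) * b.coord j (ρ (g t) (b i)) := by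
      intro i j
      rw [hP, eval_eq', Finset.mul_sum]
      refine Finset.sum_congr rfl fun s hs => ?_
      have h₁ : ∏ ij, e ij t ^ s ij = (t : ℂ) ^ (a * s.degree) * ∏ ij, g t ij.1 ij.2 ^ s ij := by
        simp only [← hge, mul_pow, Finset.prod_mul_distrib, Finset.prod_pow_eq_pow_sum,
          Finsupp.degree_eq_sum, ← pow_mul,
          Finset.mul_sum]
      have h₂ : a * d = a * (d - s.degree) + a * s.degree := by
        rw [← mul_add, Nat.sub_add_cancel (hdeg i j s hs)]
      rw [h₁, h₂, pow_add]
      ring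
    conv_rhs => rw [← b.sum_repr v]
    simp only [map_sum, map_smul, Finset.smul_sum]
    refine Finset.sum_congr rfl fun i _ => ?_
    conv_rhs => rw [← b.sum_repr (ρ (g t) (b i))]
    simp only [Finset.smul_sum, smul_smul, hc, Module.Basis.coord_apply]
    exact Finset.sum_congr rfl fun j _ => by congr 1; ring

end PolynomialMaps

/-! ### Matrices acting on `Sym^ω ℂⁿ` and `⋀ⁿ Sym^ω ℂⁿ` -/

section MatrixAction

variable {n : ℕ}

theorem eval_symAlgMap (A : Matrix (Fin n) (Fin n) ℂ) (f : MvPolynomial (Fin n) ℂ)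
    (ξ : Fin n → ℂ) : eval ξ (symAlgMap A f) = eval (ξ ᵥ* A) f := by
  induction f using MvPolynomial.induction_on with
  | C a => simp [symAlgMap]
  | add p q hp hq => simp only [map_add, hp, hq]
  | mul_X p j hp =>
    rw [map_mul, map_mul, hp, map_mul, eval_X]
    simp [symAlgMap, vecMul, dotProduct, smul_eval, mul_comm]

theorem eval_smul_of_isHomogeneous {f : MvPolynomial (Fin n) ℂ} {k : ℕ} (hf : f.IsHomogeneous k)
    (c : ℂ) (ξ : Fin n → ℂ) : eval (c • ξ) f = c ^ k * eval ξ f := by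
  rw [eval_eq', eval_eq', Finset.mul_sum]
  refine Finset.sum_congr rfl fun d hd => ?_
  have h : ∑ i, d i = k := by
    rw [← hf (mem_support_iff.1 hd), ← Finsupp.degree_eq_sum, Finsupp.degree_eq_weight_one]; rfl
  simp only [Pi.smul_apply, smul_eq_mul, mul_pow, Finset.prod_mul_distrib,
    Finset.prod_pow_eq_pow_sum, h]
  ring

theorem coe_scalar (z : ℂˣ) :
    (Matrix.GeneralLinearGroup.scalar (Fin n) z : Matrix (Fin n) (Fin n) ℂ) = (z : ℂ) • 1 := by
  ext i j
  simp [Matrix.diagonal_apply, Matrix.one_apply]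

variable (ω : Fin n → ℕ)

instance (k : ℕ) : Module.Finite ℂ (SymPow n k) :=
  Module.Finite.iff_fg.2 (homogeneousSubmodule_fg (Fin n) ℂ k)

/-- Multiplication by `c i` on the `i`-th summand of `Sym^ω ℂⁿ`. -/
def rowScale (c : Fin n → ℂ) : SymW ω →ₗ[ℂ] SymW ω :=
  LinearMap.pi fun i => c i • LinearMap.proj i

theorem symWMap_smul (z : ℂ) (A : Matrix (Fin n) (Fin n) ℂ) (v : SymW ω) :
    symWMap ω (z • A) v = rowScale ω (fun i => z ^ ω i) (symWMap ω A v) := by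
  refine funext fun i => Subtype.ext (MvPolynomial.funext fun ξ => ?_)
  change eval ξ (symAlgMap (z • A) (v i)) = eval ξ (z ^ ω i • symAlgMap A (v i : MvPolynomial _ ℂ))
  rw [smul_eval, eval_symAlgMap, eval_symAlgMap, vecMul_smul,
    eval_smul_of_isHomogeneous (v i).2]

theorem isPolyMap_symWMap {E : Type*} [AddCommGroup E] [Module ℂ E]
    {A : E → Matrix (Fin n) (Fin n) ℂ} (hA : ∀ s j, IsPolyFun fun x => A x s j) (v : SymW ω)
    (i : Fin n) : IsPolyMap fun x => symWMap ω (A x) v i := by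
  have key : ∀ (f : MvPolynomial (Fin n) ℂ) (l : Module.Dual ℂ (MvPolynomial (Fin n) ℂ)),
      IsPolyFun fun x => l (symAlgMap (A x) f) := by
    intro f
    induction f using MvPolynomial.induction_on with
    | C a => exact fun l => by simpa [symAlgMap] using IsPolyFun.const _
    | add p q hp hq => exact fun l => by simpa only [map_add] using (hp l).add (hq l)
    | mul_X p j hp =>
      intro l
      have h : ∀ x, l (symAlgMap (A x) (p * X j)) =
          ∑ s, A x s j * (l ∘ₗ LinearMap.mulRight ℂ (X s)) (symAlgMap (A x) p) := by
        intro x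
        rw [map_mul, show symAlgMap (A x) (X j) = ∑ s, A x s j • X s from aeval_X _ _,
          Finset.mul_sum, map_sum]
        simp
      simp only [h]
      exact IsPolyFun.sum fun s _ => (hA s j).mul (hp _)
  intro l
  obtain ⟨l', hl'⟩ := LinearMap.exists_extend l
  have h : ∀ x, l (symWMap ω (A x) v i) = l' (symAlgMap (A x) (v i)) := fun x => by
    rw [← hl']; rfl
  simpa only [h] using key _ l'

/-- The action of an arbitrary, possibly singular, matrix on `⋀ⁿ Sym^ω ℂⁿ`. -/
def wedgeMap (A : Matrix (Fin n) (Fin n) ℂ) : WedgeW ω →ₗ[ℂ] WedgeW ω :=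
  exteriorPower.map n (symWMap ω A)

theorem wedgeRep_apply (g : GL (Fin n) ℂ) : wedgeRep ω g = wedgeMap ω g := rfl

theorem wedgeMap_mul (A B : Matrix (Fin n) (Fin n) ℂ) (w : WedgeW ω) :
    wedgeMap ω (A * B) w = wedgeMap ω A (wedgeMap ω B w) := by
  rw [wedgeMap, symWMap_mul, exteriorPower.map_comp]; rfl

theorem wedgeMap_one (w : WedgeW ω) : wedgeMap ω 1 w = w := by
  rw [wedgeMap, symWMap_one, exteriorPower.map_id]; rfl

theorem wedgeMap_ιMulti (A : Matrix (Fin n) (Fin n) ℂ) (u : Fin n → SymW ω) :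
    wedgeMap ω A (exteriorPower.ιMulti ℂ n u) =
      exteriorPower.ιMulti ℂ n fun j => symWMap ω A (u j) :=
  exteriorPower.map_apply_ιMulti _ _

theorem isPolyMap_ιMulti {E : Type*} [AddCommGroup E] [Module ℂ E] {G : Fin n → E → SymW ω}
    (hG : ∀ j i, IsPolyMap fun x => G j x i) :
    IsPolyMap fun x => exteriorPower.ιMulti ℂ n fun j => G j x :=
  IsPolyMap.multilinear (exteriorPower.ιMulti ℂ n (M := SymW ω)).toMultilinearMap
    fun j => IsPolyMap.pi (hG j)

variable {ω}

/-- The linear form `u₁ ∧ ⋯ ∧ u_n ↦ det (L_i (u_j))` on `⋀ⁿ Sym^ω ℂⁿ`. -/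
def detForm (L : Fin n → Module.Dual ℂ (SymW ω)) : Module.Dual ℂ (WedgeW ω) :=
  exteriorPower.alternatingMapLinearEquiv
    ((Matrix.detRowAlternating (n := Fin n) (R := ℂ)).compLinearMap (LinearMap.pi L))

theorem detForm_ιMulti (L : Fin n → Module.Dual ℂ (SymW ω)) (u : Fin n → SymW ω) :
    detForm L (exteriorPower.ιMulti ℂ n u) = (Matrix.of fun j i => L i (u j)).det := by
  rw [detForm, exteriorPower.alternatingMapLinearEquiv_apply_ιMulti]; rfl

/-- Evaluation at `ξ` of the `i`-th component of an element of `Sym^ω ℂⁿ`. -/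
def evalAt (ω : Fin n → ℕ) (ξ : Fin n → ℂ) (i : Fin n) : Module.Dual ℂ (SymW ω) :=
  (aeval ξ : MvPolynomial (Fin n) ℂ →ₐ[ℂ] ℂ).toLinearMap ∘ₗ
    (homogeneousSubmodule (Fin n) ℂ (ω i)).subtype ∘ₗ LinearMap.proj i

theorem evalAt_apply (ξ : Fin n → ℂ) (i : Fin n) (v : SymW ω) :
    evalAt ω ξ i v = eval ξ (v i : MvPolynomial (Fin n) ℂ) := by
  simp [evalAt, aeval_eq_eval]

/-- The coefficient of `X s` in the `i`-th component of an element of `Sym^ω ℂⁿ`. -/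
def coeffAt (ω : Fin n → ℕ) (s i : Fin n) : Module.Dual ℂ (SymW ω) :=
  MvPolynomial.lcoeff ℂ (Finsupp.single s 1) ∘ₗ
    (homogeneousSubmodule (Fin n) ℂ (ω i)).subtype ∘ₗ LinearMap.proj i

theorem coeffAt_apply (s i : Fin n) (v : SymW ω) :
    coeffAt ω s i v = coeff (Finsupp.single s 1) (v i : MvPolynomial (Fin n) ℂ) := rfl

/-- The linear form `u₁ ∧ ⋯ ∧ u_n ↦ det (u_{j,i}(ξ))`. On `g 𝔭_n` it takes the value
`(ξ ⬝ᵥ g e₁) ^ |ω|`. -/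
def evalForm (ω : Fin n → ℕ) (ξ : Fin n → ℂ) : Module.Dual ℂ (WedgeW ω) :=
  detForm (evalAt ω ξ)

end MatrixAction

/-! ### The point `𝔭_n`, its stabiliser and its weight decomposition -/

namespace FirstRowGroup

variable {n : ℕ} [NeZero n] (D : FirstRowGroup n)

/-- The vector `∑ i, p i j (e₁, …, e_n)` of `Sym^ω ℂⁿ`. -/
def col (j : Fin n) : SymW D.ω := fun i => ⟨D.p i j, D.p_isHomogeneous i j⟩

theorem wedgeMap_pn (A : Matrix (Fin n) (Fin n) ℂ) :
    wedgeMap D.ω A D.pn = exteriorPower.ιMulti ℂ n fun j => symWMap D.ω A (D.col j) :=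
  wedgeMap_ιMulti _ _ _

theorem ω_pos (i : Fin n) : 0 < D.ω i := by
  rcases eq_or_ne i 0 with rfl | h
  · simp [D.ω_zero]
  · exact zero_lt_one.trans (D.one_lt_ω i h)

theorem eval_single_p (i j : Fin n) :
    eval (Pi.single 0 1) (D.p i j) = (1 : Matrix (Fin n) (Fin n) ℂ) i j := by
  obtain ⟨α, -, hα⟩ := (D.mem_Uhat 1).1 D.Uhat.one_mem
  have h : α = Pi.single 0 1 := by
    funext k
    have := hα 0 k
    rw [D.p_first, eval_X] at this
    rw [← this, Units.val_one, Matrix.one_apply, Pi.single_apply]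
    simp only [eq_comm]
  rw [← h, ← hα]; rfl

/-- The group law of `Û`, as an identity between polynomials: `p(α u) = p(α) u` for `u ∈ Û`. -/
theorem symAlgMap_p {u : GL (Fin n) ℂ} (hu : u ∈ D.Uhat) (i j : Fin n) :
    symAlgMap u (D.p i j) = ∑ l, C (u l j) * D.p i l := by
  refine mul_left_cancel₀ (X_ne_zero (R := ℂ) (0 : Fin n)) (MvPolynomial.funext fun α => ?_)
  rw [map_mul, map_mul, eval_X]
  rcases eq_or_ne (α 0) 0 with h0 | h0
  · simp [h0]
  congr 1
  have hdet : (D.rowMatrix α).det ≠ 0 := by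
    rw [det_rowMatrix]
    exact Finset.prod_ne_zero_iff.2 fun _ _ => pow_ne_zero _ h0
  let h : GL (Fin n) ℂ := Matrix.GeneralLinearGroup.mkOfDetNeZero _ hdet
  have hh : h ∈ D.Uhat := (D.mem_Uhat h).2 ⟨α, h0, fun _ _ => rfl⟩
  obtain ⟨β, -, hβ⟩ := (D.mem_Uhat (h * u)).1 (D.Uhat.mul_mem hh hu)
  have hhu : ∀ i j, (h * u) i j = ∑ l, eval α (D.p i l) * u l j := fun i j => rfl
  have hβα : β = α ᵥ* (u : Matrix (Fin n) (Fin n) ℂ) := by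
    funext k
    have := hβ 0 k
    rw [hhu, D.p_first k, eval_X] at this
    rw [← this]
    simp [vecMul, dotProduct, D.p_first]
  rw [eval_symAlgMap, ← hβα, ← hβ, hhu]
  simp [mul_comm]

theorem symWMap_col {u : GL (Fin n) ℂ} (hu : u ∈ D.Uhat) (j : Fin n) :
    symWMap D.ω u (D.col j) = ∑ l, u l j • D.col l := by
  refine funext fun i => Subtype.ext ?_
  rw [Finset.sum_apply, AddSubmonoidClass.coe_finsetSum]
  refine (D.symAlgMap_p hu i j).trans (Finset.sum_congr rfl fun l _ => ?_)
  rw [C_mul']; rfl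

theorem wedgeMap_pn_of_mem {u : GL (Fin n) ℂ} (hu : u ∈ D.Uhat) :
    wedgeMap D.ω u D.pn = (u : Matrix (Fin n) (Fin n) ℂ).det • D.pn := by
  rw [← sub_eq_zero, ← Module.forall_dual_apply_eq_zero_iff ℂ]
  intro l
  -- `f` is the alternating form `a ↦ l (⋀_j ∑_k a_{j k} col k)` on `ℂⁿ`, a multiple of `det`.
  let f : (Fin n → ℂ) [⋀^Fin n]→ₗ[ℂ] ℂ :=
    (l.compAlternatingMap (exteriorPower.ιMulti ℂ n)).compLinearMap
      (Fintype.linearCombination ℂ D.col)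
  have hf := f.eq_smul_basis_det (Pi.basisFun ℂ (Fin n))
  have h₁ : f (fun j k => u k j) = l (wedgeMap D.ω u D.pn) := by
    rw [wedgeMap_pn]
    simp only [D.symWMap_col hu]
    rfl
  have h₂ : f (Pi.basisFun ℂ (Fin n)) = l D.pn := by
    have h : ∀ j, Fintype.linearCombination ℂ D.col (Pi.basisFun ℂ (Fin n) j) = D.col j := by
      intro j
      simp [Fintype.linearCombination_apply_single]
    change l (exteriorPower.ιMulti ℂ n fun j =>
      Fintype.linearCombination ℂ D.col (Pi.basisFun ℂ (Fin n) j)) = _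
    simp only [h]
    rfl
  have h₃ : (Pi.basisFun ℂ (Fin n)).det (fun j k => u k j) =
      (u : Matrix (Fin n) (Fin n) ℂ).det := by
    rw [Pi.basisFun_det_apply]
    exact Matrix.det_transpose (u : Matrix (Fin n) (Fin n) ℂ)
  rw [map_sub, map_smul, ← h₁, hf, AlternatingMap.smul_apply, h₂, h₃, smul_eq_mul, smul_eq_mul]
  ring

theorem evalForm_wedgeMap_pn (A : Matrix (Fin n) (Fin n) ℂ) (ξ : Fin n → ℂ) :
    evalForm D.ω ξ (wedgeMap D.ω A D.pn) = (ξ ᵥ* A) 0 ^ D.ωsum := by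
  rw [evalForm, wedgeMap_pn, detForm_ιMulti, ← Matrix.det_transpose, ωsum,
    ← Finset.prod_pow_eq_pow_sum, ← D.det_rowMatrix]
  congr 1
  ext i j
  simp only [transpose_apply, of_apply, evalAt_apply, rowMatrix]
  exact eval_symAlgMap _ _ _

theorem torus_det_ne_zero {t : ℂ} (ht : t ≠ 0) :
    (Matrix.diagonal fun i => t ^ D.ω i).det ≠ 0 := by
  rw [Matrix.det_diagonal]
  exact Finset.prod_ne_zero_iff.2 fun _ _ => pow_ne_zero _ ht

/-- The element `diag(t ^ ω₁, …, t ^ ω_n)` of `Û`. -/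
def torus (t : ℂˣ) : GL (Fin n) ℂ :=
  Matrix.GeneralLinearGroup.mkOfDetNeZero _ (D.torus_det_ne_zero t.ne_zero)

theorem coe_torus (t : ℂˣ) :
    (D.torus t : Matrix (Fin n) (Fin n) ℂ) = Matrix.diagonal fun i => (t : ℂ) ^ D.ω i := rfl

theorem wedgeMap_torus_pn (t : ℂˣ) :
    wedgeMap D.ω (D.torus t) D.pn = (t : ℂ) ^ D.ωsum • D.pn := by
  rw [D.wedgeMap_pn_of_mem (D.torus_mem _ t rfl), coe_torus, Matrix.det_diagonal,
    Finset.prod_pow_eq_pow_sum, ωsum]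

/-- The matrix `(p i j)` has no entries off the diagonal between indices of equal weight: such an
entry is invariant under conjugation by `ℂˣ`, which contracts `Û` to its diagonal matrices. -/
theorem p_eq_zero {i j : Fin n} (hij : i ≠ j) (hω : D.ω i = D.ω j) : D.p i j = 0 := by
  refine MvPolynomial.funext fun α => ?_
  have key : ∀ t : ℂˣ, eval (fun k => (t : ℂ) ^ (D.ω k - 1) * α k) (D.p i j) =
      eval α (D.p i j) := by
    intro t
    have h := congrArg (eval α) (D.symAlgMap_p (D.torus_mem (D.torus t) t rfl) i j)
    have h₁ : ∑ l, C (D.torus t l j) * D.p i l = C ((t : ℂ) ^ D.ω j) * D.p i j := by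
      rw [Finset.sum_eq_single j]
      · simp [coe_torus]
      · intro l _ hl
        simp [coe_torus, hl]
      · simp
    have h₂ : α ᵥ* (D.torus t : Matrix (Fin n) (Fin n) ℂ) =
        (t : ℂ) • fun k => (t : ℂ) ^ (D.ω k - 1) * α k := by
      funext k
      rw [coe_torus, vecMul_diagonal, Pi.smul_apply, smul_eq_mul, ← mul_assoc, ← pow_succ',
        Nat.sub_add_cancel (D.ω_pos k), mul_comm]
    rw [h₁, eval_symAlgMap, h₂, eval_smul_of_isHomogeneous (D.p_isHomogeneous i j), map_mul,
      eval_C, hω] at h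
    exact mul_left_cancel₀ (pow_ne_zero _ t.ne_zero) h
  have h := eq_at_zero_of_forall_units
    (f := fun t => eval (fun k => t ^ (D.ω k - 1) * α k) (D.p i j))
    (g := fun _ => eval α (D.p i j))
    ((MvPolynomial.continuous_eval _).comp (by fun_prop)) continuous_const key
  have h₀ : (fun k => (0 : ℂ) ^ (D.ω k - 1) * α k) = α 0 • Pi.single 0 1 := by
    funext k
    rcases eq_or_ne k 0 with rfl | hk
    · simp [D.ω_zero]
    · have := D.one_lt_ω k hk
      simp [hk, show D.ω k - 1 ≠ 0 by omega]
  simp only [h₀] at h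
  rw [← h, eval_smul_of_isHomogeneous (D.p_isHomogeneous i j), D.eval_single_p,
    Matrix.one_apply_ne hij, mul_zero, map_zero]

/-- The central weight of the summand spanned by products with `j`-th factor in
`Sym^{ω_{k j}} ℂⁿ`. -/
def wt (k : Fin n → Fin n) : ℕ := ∑ j, D.ω (k j)

/-- The product `⋀_j p (k j) j (e₁, …, e_n)`, the `j`-th factor in the `k j`-th summand of
`Sym^ω ℂⁿ`. -/
def pnTerm (k : Fin n → Fin n) : WedgeW D.ω :=
  exteriorPower.ιMulti ℂ n fun j =>
    LinearMap.single ℂ (fun i => SymPow n (D.ω i)) (k j) (D.col j (k j))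

/-- The component of `𝔭_n` of central weight `m`. -/
def pnComp (m : ℕ) : WedgeW D.ω := ∑ k with D.wt k = m, D.pnTerm k

theorem le_of_pnTerm_ne_zero {k : Fin n → Fin n} (hk : D.pnTerm k ≠ 0) (j : Fin n) :
    k j ≤ j := by
  by_contra! h
  refine hk (AlternatingMap.map_coord_zero _ j ?_)
  have : D.col j (k j) = 0 := Subtype.ext (D.p_lower _ _ h)
  rw [this, map_zero]

theorem wt_le_of_pnTerm_ne_zero {k : Fin n → Fin n} (hk : D.pnTerm k ≠ 0) : D.wt k ≤ D.ωsum :=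
  Finset.sum_le_sum fun j _ => D.ω_mono (D.le_of_pnTerm_ne_zero hk j)

theorem symWMap_scalar_single (z : ℂ) (i : Fin n) (f : SymPow n (D.ω i)) :
    symWMap D.ω (z • 1) (LinearMap.single ℂ (fun i => SymPow n (D.ω i)) i f) =
      z ^ D.ω i • LinearMap.single ℂ (fun i => SymPow n (D.ω i)) i f := by
  rw [symWMap_smul, symWMap_one]
  funext i'
  rcases eq_or_ne i' i with rfl | h
  · simp [rowScale]
  · simp [rowScale, h]

theorem wedgeMap_scalar_pnTerm (z : ℂ) (k : Fin n → Fin n) :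
    wedgeMap D.ω (z • 1) (D.pnTerm k) = z ^ D.wt k • D.pnTerm k := by
  rw [pnTerm, wedgeMap_ιMulti]
  simp only [symWMap_scalar_single]
  have h := (exteriorPower.ιMulti ℂ n (M := SymW D.ω)).toMultilinearMap.map_smul_univ
    (fun j => z ^ D.ω (k j))
    fun j => LinearMap.single ℂ (fun i => SymPow n (D.ω i)) (k j) (D.col j (k j))
  rw [Finset.prod_pow_eq_pow_sum] at h
  exact h

theorem wedgeMap_scalar_pnComp (z : ℂ) (m : ℕ) :
    wedgeMap D.ω (z • 1) (D.pnComp m) = z ^ m • D.pnComp m := by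
  rw [pnComp, map_sum, Finset.smul_sum]
  refine Finset.sum_congr rfl fun k hk => ?_
  rw [wedgeMap_scalar_pnTerm, (Finset.mem_filter.1 hk).2]

theorem pn_eq_sum_pnTerm : D.pn = ∑ k, D.pnTerm k := by
  have h : D.pn = exteriorPower.ιMulti ℂ n fun j => ∑ i,
      LinearMap.single ℂ (fun i => SymPow n (D.ω i)) i (D.col j i) :=
    congrArg _ (funext fun j => (LinearMap.sum_single_apply _ (D.col j)).symm)
  rw [h]
  exact MultilinearMap.map_sum (exteriorPower.ιMulti ℂ n (M := SymW D.ω)).toMultilinearMap _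

theorem pn_eq_sum : D.pn = ∑ m ∈ Finset.range (D.ωsum + 1), D.pnComp m := by
  rw [pn_eq_sum_pnTerm]
  simp only [pnComp, Finset.sum_filter]
  rw [Finset.sum_comm]
  refine Finset.sum_congr rfl fun k _ => ?_
  rw [Finset.sum_ite_eq]
  split_ifs with hk
  · rfl
  · by_contra h
    exact hk (Finset.mem_range_succ_iff.2 (D.wt_le_of_pnTerm_ne_zero h))

theorem wedgeMap_scalar_pn (z : ℂ) :
    wedgeMap D.ω (z • 1) D.pn = ∑ m ∈ Finset.range (D.ωsum + 1), z ^ m • D.pnComp m := by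
  rw [pn_eq_sum, map_sum]
  simp only [wedgeMap_scalar_pnComp]

/-- The component of `𝔭_n` of highest weight is `e₁ ∧ e₁ ^ ω₂ ∧ ⋯ ∧ e₁ ^ ω_n`. -/
theorem pnComp_ωsum : D.pnComp D.ωsum = D.pnTerm id := by
  rw [pnComp, Finset.sum_eq_single_of_mem id
    (by rw [Finset.mem_filter]; exact ⟨Finset.mem_univ _, rfl⟩)]
  intro k hk hkid
  by_contra h
  have hle := D.le_of_pnTerm_ne_zero h
  have hω : ∀ j, D.ω (k j) = D.ω j := fun j =>
    (Finset.sum_eq_sum_iff_of_le fun j _ => D.ω_mono (hle j)).1 (Finset.mem_filter.1 hk).2 j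
      (Finset.mem_univ j)
  obtain ⟨j, hj⟩ : ∃ j, k j ≠ j := by
    by_contra! h'
    exact hkid (funext h')
  refine h (AlternatingMap.map_coord_zero _ j ?_)
  have : D.col j (k j) = 0 := Subtype.ext (D.p_eq_zero hj (hω j))
  rw [this, map_zero]

/-- The component of `𝔭_n` of lowest weight is `e₁ ∧ ⋯ ∧ e_n` in the first summand. -/
theorem pnComp_ne_zero : D.pnComp n ≠ 0 := by
  have h : D.pnComp n = D.pnTerm 0 := by
    rw [pnComp, Finset.sum_eq_single_of_mem 0
      (by rw [Finset.mem_filter]; exact ⟨Finset.mem_univ _, by simp [wt, D.ω_zero]⟩)]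
    intro k hk hk0
    exfalso
    have h₁ : ∑ _j : Fin n, 1 = ∑ j, D.ω (k j) := by
      rw [show ∑ j, D.ω (k j) = n from (Finset.mem_filter.1 hk).2]; simp
    refine hk0 (funext fun j => by_contra fun hj => ?_)
    have h₂ := (Finset.sum_eq_sum_iff_of_le fun j _ => D.ω_pos (k j)).1 h₁ j (Finset.mem_univ j)
    exact absurd h₂ (D.one_lt_ω _ hj).ne
  have h₁ : detForm (fun i => coeffAt D.ω i 0) (D.pnTerm 0) = 1 := by
    rw [pnTerm, detForm_ιMulti, ← Matrix.det_one (n := Fin n) (R := ℂ)]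
    congr 1
    ext j i
    rw [of_apply, coeffAt_apply, Matrix.one_apply]
    simp [col, D.p_first, coeff_X, Finsupp.single_left_inj]
  intro h0
  rw [h] at h0
  simp [h0] at h₁

theorem n_lt_ωsum : n < D.ωsum := by
  have h : ∑ _i : Fin n, 1 < ∑ i, D.ω i := by
    refine Finset.sum_lt_sum (fun i _ => D.ω_pos i) ⟨⟨1, D.two_le⟩, Finset.mem_univ _, ?_⟩
    exact D.one_lt_ω _ fun h => by simpa using congrArg Fin.val h
  simpa [ωsum] using h

end FirstRowGroup

/-! ### The linear span of the orbit and its weights -/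

/-- Powers of linear forms span the homogeneous polynomials, in dual form: if
`∑ a_l δ_{v_l}` kills the `d`-th powers of linear forms, it kills all monomials of degree `d`. -/
theorem sum_mul_prod_pow_eq_zero {n : ℕ} {ι : Type*} (S : Finset ι) (a : ι → ℂ)
    (v : ι → Fin n → ℂ) (d : ℕ) (h : ∀ ξ : Fin n → ℂ, ∑ l ∈ S, a l * (ξ ⬝ᵥ v l) ^ d = 0)
    (k : Fin n → ℕ) (hk : ∑ s, k s = d) : ∑ l ∈ S, a l * ∏ s, v l s ^ k s = 0 := by
  let R : MvPolynomial (Fin n) ℂ := ∑ k ∈ Finset.piAntidiag Finset.univ d,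
    monomial (Finsupp.equivFunOnFinite.symm k)
      (Nat.multinomial Finset.univ k * ∑ l ∈ S, a l * ∏ s, v l s ^ k s)
  have hR : R = 0 := by
    refine MvPolynomial.funext fun ξ => ?_
    rw [map_zero, ← h ξ]
    simp only [R, map_sum, eval_monomial, dotProduct, Finset.sum_pow_eq_sum_piAntidiag,
      Finset.mul_sum]
    rw [Finset.sum_comm]
    refine Finset.sum_congr rfl fun l _ => Finset.sum_congr rfl fun k _ => ?_
    rw [Finsupp.prod_fintype _ _ fun _ => pow_zero _]
    simp only [mul_pow, Finset.prod_mul_distrib, Finsupp.equivFunOnFinite_symm_apply_apply]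
    ring
  have hc : coeff (Finsupp.equivFunOnFinite.symm k) R =
      Nat.multinomial Finset.univ k * ∑ l ∈ S, a l * ∏ s, v l s ^ k s := by
    rw [coeff_sum, Finset.sum_eq_single_of_mem k (Finset.mem_piAntidiag.2 ⟨hk, by simp⟩)]
    · simp
    · intro k' _ hk'
      rw [coeff_monomial, if_neg fun e => hk' (Finsupp.equivFunOnFinite.symm.injective e)]
  rw [hR, coeff_zero] at hc
  refine (mul_eq_zero.1 hc.symm).resolve_left (Nat.cast_ne_zero.2 ?_)
  exact Nat.multinomial_pos _ _ |>.ne'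

theorem eq_zero_of_mem_zariskiClosure {E : Type*} [AddCommGroup E] [Module ℂ E]
    {S : Set (ℙ ℂ E)} {x : ℙ ℂ E} (hx : x ∈ zariskiClosure S) (l : Module.Dual ℂ E)
    (hl : ∀ s ∈ S, l s.rep = 0) : l x.rep = 0 :=
  hx 1 (fun v => l v) (IsPolyFun.linear l) (by simp) hl

namespace FirstRowGroup

variable {n : ℕ} [NeZero n] (D : FirstRowGroup n)

/-- The linear span of the cone over `GL(n)/Û`. -/
def orbitSpan : Submodule ℂ (WedgeW D.ω) :=
  Submodule.span ℂ (Set.range fun g : GL (Fin n) ℂ => wedgeMap D.ω g D.pn)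

theorem wedgeMap_GL_ne_zero (g : GL (Fin n) ℂ) {w : WedgeW D.ω} (hw : w ≠ 0) :
    wedgeMap D.ω g w ≠ 0 := by
  intro h
  refine hw ?_
  rw [← wedgeMap_one D.ω w, ← Units.val_one, ← inv_mul_cancel g, Units.val_mul, wedgeMap_mul, h,
    map_zero]

theorem pn_ne_zero : D.pn ≠ 0 := by
  intro h
  have := D.evalForm_wedgeMap_pn 1 (Pi.single 0 1)
  simp [h] at this

theorem exists_rep_eq {x : ℙ ℂ (WedgeW D.ω)} (hx : x ∈ D.orbit) :
    ∃ (g : GL (Fin n) ℂ) (c : ℂ), x.rep = c • wedgeMap D.ω g D.pn := by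
  obtain ⟨g, hg⟩ := hx
  have h : x.rep ∈ x.submodule := by
    rw [Projectivization.submodule_eq]; exact Submodule.mem_span_singleton_self _
  rw [hg] at h
  obtain ⟨c, hc⟩ := Submodule.mem_span_singleton.1 h
  exact ⟨g, c, hc.symm⟩

/-- The scalar `c` cannot be zero, as `x.rep` is not. -/
theorem mem_orbit_of_rep_eq {x : ℙ ℂ (WedgeW D.ω)} {g : GL (Fin n) ℂ} {c : ℂ}
    (h : x.rep = c • wedgeMap D.ω g D.pn) : x ∈ D.orbit := by
  refine ⟨g, ?_⟩
  have hc : c ≠ 0 := by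
    rintro rfl
    exact x.rep_nonzero (by rw [h, zero_smul])
  rw [Projectivization.submodule_eq, h, Submodule.span_singleton_smul_eq hc.isUnit]
  rfl

theorem rep_mem_orbitSpan {x : ℙ ℂ (WedgeW D.ω)} (hx : x ∈ D.orbitClosure) :
    x.rep ∈ D.orbitSpan := by
  by_contra h
  obtain ⟨l, hl, hS⟩ := Submodule.exists_le_ker_of_notMem h
  refine hl (eq_zero_of_mem_zariskiClosure hx l fun s hs => ?_)
  obtain ⟨g, c, hg⟩ := D.exists_rep_eq hs
  rw [hg, map_smul, show l (wedgeMap D.ω g D.pn) = 0 from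
    hS (Submodule.subset_span (Set.mem_range_self g)), smul_zero]

theorem orbitSpan_le : D.orbitSpan ≤ ⨆ x ∈ D.orbitClosure, x.submodule := by
  refine Submodule.span_le.2 ?_
  rintro _ ⟨g, rfl⟩
  have h := D.wedgeMap_GL_ne_zero g D.pn_ne_zero
  have hx : Projectivization.mk ℂ _ h ∈ D.orbitClosure :=
    fun _ _ _ _ H => H _ ⟨g, Projectivization.submodule_mk _ _⟩
  refine Submodule.mem_iSup_of_mem _ (Submodule.mem_iSup_of_mem hx ?_)
  rw [Projectivization.submodule_mk]
  exact Submodule.mem_span_singleton_self _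

theorem isCentralWeight_of_mem {m : ℕ} {w : WedgeW D.ω} (hw : w ∈ D.orbitSpan) (h0 : w ≠ 0)
    (h : ∀ z : ℂ, wedgeMap D.ω (z • 1) w = z ^ m • w) : D.IsCentralWeight m := by
  refine ⟨w, D.orbitSpan_le hw, h0, fun z => ?_⟩
  rw [← h, wedgeRep_apply, coe_scalar]

theorem wedgeMap_mem_orbitSpan (g : GL (Fin n) ℂ) {w : WedgeW D.ω} (hw : w ∈ D.orbitSpan) :
    wedgeMap D.ω g w ∈ D.orbitSpan := by
  induction hw using Submodule.span_induction with
  | mem w hw =>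
    obtain ⟨h, rfl⟩ := hw
    rw [← wedgeMap_mul]
    exact Submodule.subset_span ⟨g * h, rfl⟩
  | zero => simp
  | add u v _ _ hu hv => rw [map_add]; exact add_mem hu hv
  | smul c u _ hu => rw [map_smul]; exact Submodule.smul_mem _ c hu

theorem pnComp_mem_orbitSpan {m : ℕ} (hm : m ≤ D.ωsum) : D.pnComp m ∈ D.orbitSpan := by
  refine mem_of_forall_sum_pow_smul_mem (k := D.ωsum + 1) (fun t => ?_) (Nat.lt_succ_of_le hm)
  rw [← wedgeMap_scalar_pn]
  refine Submodule.subset_span ⟨Matrix.GeneralLinearGroup.scalar (Fin n) t, ?_⟩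
  simp only [coe_scalar]

theorem le_ωsecond {m : ℕ} (hm : D.IsCentralWeight m) (h : m < D.ωsum) : m ≤ D.ωsecond :=
  le_csSup ⟨D.ωsum, fun _ hk => hk.2.le⟩ ⟨hm, h⟩

theorem n_le_ωsecond : n ≤ D.ωsecond :=
  D.le_ωsecond (D.isCentralWeight_of_mem (D.pnComp_mem_orbitSpan D.n_lt_ωsum.le) D.pnComp_ne_zero
    fun z => D.wedgeMap_scalar_pnComp z n) D.n_lt_ωsum

/-- The translate `⋀_i (A e₁) ^ ω_i` of the highest component of `𝔭_n` is a homogeneous polynomial of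
degree `|ω|` in the vector `A e₁`. -/
theorem exists_wedgeMap_pnTerm_id_eq :
    ∃ (R : Finset (Fin n → Fin n → ℕ)) (T : (Fin n → Fin n → ℕ) → WedgeW D.ω),
      (∀ r ∈ R, ∑ s, ∑ j, r j s = D.ωsum) ∧
      ∀ A : Matrix (Fin n) (Fin n) ℂ, wedgeMap D.ω A (D.pnTerm id) =
        ∑ r ∈ R, (∏ s, A s 0 ^ ∑ j, r j s) • T r := by
  let π : (j : Fin n) → MvPolynomial (Fin n) ℂ →ₗ[ℂ] SymW D.ω := fun j =>
    LinearMap.single ℂ (fun i => SymPow n (D.ω i)) j ∘ₗ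
      LinearMap.codRestrict _ (homogeneousComponent (D.ω j)) fun f =>
        homogeneousComponent_mem (D.ω j) f
  refine ⟨Fintype.piFinset fun j => Finset.piAntidiag Finset.univ (D.ω j), fun r =>
    (∏ j, (Nat.multinomial Finset.univ (r j) : ℂ)) •
      exteriorPower.ιMulti ℂ n fun j => π j (∏ s, X s ^ r j s), fun r hr => ?_, fun A => ?_⟩
  · rw [Finset.sum_comm]
    exact Finset.sum_congr rfl fun j _ =>
      (Finset.mem_piAntidiag.1 (Fintype.mem_piFinset.1 hr j)).1
  · have hu : ∀ j, symWMap D.ω A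
          (LinearMap.single ℂ (fun i => SymPow n (D.ω i)) j (D.col j j)) =
        ∑ k ∈ Finset.piAntidiag Finset.univ (D.ω j),
          ((Nat.multinomial Finset.univ k : ℂ) * ∏ s, A s 0 ^ k s) • π j (∏ s, X s ^ k s) := by
      intro j
      have h₁ : symAlgMap A (D.p j j) = ∑ k ∈ Finset.piAntidiag Finset.univ (D.ω j),
          ((Nat.multinomial Finset.univ k : ℂ) * ∏ s, A s 0 ^ k s) • ∏ s, X s ^ k s := by
        rw [D.p_diag, map_pow, show symAlgMap A (X 0) = ∑ s, A s 0 • X s from aeval_X _ _,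
          Finset.sum_pow_eq_sum_piAntidiag]
        refine Finset.sum_congr rfl fun k _ => ?_
        simp only [smul_eq_C_mul, mul_pow, Finset.prod_mul_distrib, map_mul, map_prod, map_pow,
          map_natCast]
        ring
      simp only [← map_smul, ← map_sum, ← h₁]
      have h₂ : homogeneousComponent (D.ω j) (symAlgMap A (D.p j j)) = symAlgMap A (D.p j j) := by
        rw [homogeneousComponent_of_mem (symAlgMap_mem A _ _ (D.p_isHomogeneous j j)), if_pos rfl]
      funext i
      rcases eq_or_ne i j with rfl | hij
      · refine Subtype.ext ?_
        have h₃ : (symWMap D.ω A (Pi.single i (D.col i i)) i : MvPolynomial (Fin n) ℂ) =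
            symAlgMap A ((Pi.single i (D.col i i) : SymW D.ω) i) := rfl
        simp only [π, LinearMap.comp_apply, LinearMap.single_apply, h₃, Pi.single_eq_same]
        exact h₂.symm
      · refine Subtype.ext ?_
        simp [π, symWMap, hij]
    rw [pnTerm, wedgeMap_ιMulti]
    simp only [id, hu]
    refine (MultilinearMap.map_sum_finset
      (exteriorPower.ιMulti ℂ n (M := SymW D.ω)).toMultilinearMap _ _).trans ?_
    refine Finset.sum_congr rfl fun r _ => ?_
    rw [MultilinearMap.map_smul_univ, smul_smul]
    congr 1
    rw [Finset.prod_mul_distrib, mul_comm, Finset.prod_comm]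
    simp only [Finset.prod_pow_eq_pow_sum]

/-- A vector in the span of the orbit on which all the forms `evalForm ξ` vanish has no component
of the highest weight `|ω|`, hence only components of weight at most `ω_{max-1}`. -/
theorem exists_weight_decomposition {w : WedgeW D.ω} (hw : w ∈ D.orbitSpan)
    (h : ∀ ξ, evalForm D.ω ξ w = 0) :
    ∃ Q : ℕ → WedgeW D.ω, (∀ m, D.ωsecond < m → Q m = 0) ∧
      ∀ z : ℂ, wedgeMap D.ω (z • 1) w = ∑ m ∈ Finset.range (D.ωsum + 1), z ^ m • Q m := by
  obtain ⟨a, rfl⟩ := (Finsupp.mem_span_range_iff_exists_finsupp).1 hw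
  let Q : ℕ → WedgeW D.ω := fun m => a.sum fun g c => c • wedgeMap D.ω g (D.pnComp m)
  have hcomm : ∀ (z : ℂ) (g : GL (Fin n) ℂ) (w : WedgeW D.ω),
      wedgeMap D.ω (z • 1) (wedgeMap D.ω g w) = wedgeMap D.ω g (wedgeMap D.ω (z • 1) w) := by
    intro z g w
    rw [← wedgeMap_mul, ← wedgeMap_mul, Matrix.smul_mul, Matrix.mul_smul, one_mul, mul_one]
  have htop : Q D.ωsum = 0 := by
    obtain ⟨R, T, hR, hT⟩ := D.exists_wedgeMap_pnTerm_id_eq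
    have h' : ∀ ξ : Fin n → ℂ, ∑ g ∈ a.support, a g * (ξ ⬝ᵥ fun s => g s 0) ^ D.ωsum = 0 := by
      intro ξ
      rw [← h ξ, Finsupp.sum, map_sum]
      refine Finset.sum_congr rfl fun g _ => ?_
      rw [map_smul, D.evalForm_wedgeMap_pn, smul_eq_mul]
      rfl
    simp only [Q, Finsupp.sum, D.pnComp_ωsum, hT, Finset.smul_sum, smul_smul]
    rw [Finset.sum_comm]
    refine Finset.sum_eq_zero fun r hr => ?_
    rw [← Finset.sum_smul, sum_mul_prod_pow_eq_zero a.support a (fun g s => g s 0) D.ωsum h' _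
      (hR r hr), zero_smul]
  refine ⟨fun m => if m ≤ D.ωsum then Q m else 0, fun m hm => ?_, fun z => ?_⟩
  · beta_reduce
    split_ifs with hle
    · rcases hle.lt_or_eq with hlt | rfl
      · by_contra h0
        refine absurd (D.le_ωsecond (D.isCentralWeight_of_mem (w := Q m) ?_ h0 fun z => ?_) hlt)
          hm.not_ge
        · exact Submodule.sum_mem _ fun g _ => Submodule.smul_mem _ _
            (D.wedgeMap_mem_orbitSpan g (D.pnComp_mem_orbitSpan hle))
        · simp only [Q, Finsupp.sum, map_sum, Finset.smul_sum, map_smul, hcomm,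
            wedgeMap_scalar_pnComp]
          exact Finset.sum_congr rfl fun g _ => smul_comm _ _ _
      · exact htop
    · rfl
  · have h₁ : ∀ m ∈ Finset.range (D.ωsum + 1), z ^ m • (if m ≤ D.ωsum then Q m else 0) =
        ∑ g ∈ a.support, z ^ m • a g • wedgeMap D.ω g (D.pnComp m) := by
      intro m hm
      rw [if_pos (Finset.mem_range_succ_iff.1 hm), ← Finset.smul_sum]
      rfl
    rw [Finset.sum_congr rfl h₁, Finset.sum_comm, Finsupp.sum, map_sum]
    refine Finset.sum_congr rfl fun g _ => ?_
    rw [map_smul, hcomm, wedgeMap_scalar_pn, map_sum, Finset.smul_sum]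
    refine Finset.sum_congr rfl fun m _ => ?_
    rw [map_smul, smul_comm]

end FirstRowGroup

/-! ### Affine charts of the orbit closure -/

namespace FirstRowGroup

variable {n : ℕ} [NeZero n] (D : FirstRowGroup n)

/-- The matrix of linear forms on `⋀ⁿ Sym^ω ℂⁿ` that recovers `g` from `g 𝔭_n` when `ξ g = (1, 0, …, 0)`:
its `(s, j)` entry is the determinant defining `evalForm ξ`, with the `j`-th linear form replaced by
the coefficient of `e_s` in the first summand. -/
def chart (ξ : Fin n → ℂ) (w : WedgeW D.ω) : Matrix (Fin n) (Fin n) ℂ :=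
  of fun s j => detForm (fun i => if i = j then coeffAt D.ω s 0 else evalAt D.ω ξ i) w

theorem chart_smul (ξ : Fin n → ℂ) (c : ℂ) (w : WedgeW D.ω) :
    D.chart ξ (c • w) = c • D.chart ξ w := by
  ext s j
  simp [chart]

theorem chart_wedgeMap_pn {ξ : Fin n → ℂ} {A : Matrix (Fin n) (Fin n) ℂ}
    (hA : ξ ᵥ* A = Pi.single 0 1) : D.chart ξ (wedgeMap D.ω A D.pn) = A := by
  ext s j
  rw [chart, of_apply, wedgeMap_pn, detForm_ιMulti]
  have h : (of fun k i => (if i = j then coeffAt D.ω s 0 else evalAt D.ω ξ i)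
      (symWMap D.ω A (D.col k))) = (1 : Matrix (Fin n) (Fin n) ℂ).updateCol j (A s) := by
    ext k i
    rw [of_apply, updateCol_apply]
    split_ifs with hij
    · rw [coeffAt_apply]
      change coeff _ (symAlgMap A (D.p 0 k)) = _
      rw [D.p_first, show symAlgMap A (X k) = ∑ s, A s k • X s from aeval_X _ _, coeff_sum]
      simp [coeff_X, Finsupp.single_left_inj]
    · rw [evalAt_apply]
      change eval ξ (symAlgMap A (D.p i k)) = _
      rw [eval_symAlgMap, hA, D.eval_single_p, Matrix.one_apply, Matrix.one_apply]
      simp only [eq_comm]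
  rw [h, ← Matrix.cramer_apply, Matrix.cramer_one]
  rfl

/-- The matrix `g` of a point `g 𝔭_n` with `(ξ g)₁ ≠ 0` may be chosen such that
`ξ g = (1, 0, …, 0)`, since `Û` acts simply transitively on the first rows. -/
theorem exists_normalised (ξ : Fin n → ℂ) (g : GL (Fin n) ℂ)
    (hg : (ξ ᵥ* (g : Matrix (Fin n) (Fin n) ℂ)) 0 ≠ 0) :
    ∃ (A : Matrix (Fin n) (Fin n) ℂ) (c : ℂ), ξ ᵥ* A = Pi.single 0 1 ∧
      wedgeMap D.ω g D.pn = c • wedgeMap D.ω A D.pn := by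
  set α := ξ ᵥ* (g : Matrix (Fin n) (Fin n) ℂ) with hα
  have hdet : (D.rowMatrix α).det ≠ 0 := by
    rw [det_rowMatrix]
    exact Finset.prod_ne_zero_iff.2 fun _ _ => pow_ne_zero _ hg
  let u : GL (Fin n) ℂ := Matrix.GeneralLinearGroup.mkOfDetNeZero _ hdet
  have hu : u ∈ D.Uhat := (D.mem_Uhat u).2 ⟨α, hg, fun _ _ => rfl⟩
  refine ⟨(g * u⁻¹ : GL (Fin n) ℂ), (u : Matrix (Fin n) (Fin n) ℂ).det, ?_, ?_⟩
  · have h : α = Pi.single 0 1 ᵥ* (u : Matrix (Fin n) (Fin n) ℂ) := by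
      funext k
      rw [single_one_vecMul]
      change α k = eval α (D.p 0 k)
      rw [D.p_first, eval_X]
    rw [Units.val_mul, ← vecMul_vecMul, ← hα, h, vecMul_vecMul, ← Units.val_mul, mul_inv_cancel,
      Units.val_one, vecMul_one]
  · rw [← map_smul, ← D.wedgeMap_pn_of_mem hu, ← wedgeMap_mul, ← Units.val_mul,
      inv_mul_cancel_right]

/-- With `y = evalForm ξ w` and `A = y⁻¹ • chart ξ w`, this is `y ^ (n |ω|) • A 𝔭_n`, written without
denominators as a homogeneous polynomial of degree `n |ω|` in `w`. -/
def chartInv (ξ : Fin n → ℂ) (w : WedgeW D.ω) : WedgeW D.ω :=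
  exteriorPower.ιMulti ℂ n fun j => rowScale D.ω (fun i => evalForm D.ω ξ w ^ (D.ωsum - D.ω i))
    (symWMap D.ω (D.chart ξ w) (D.col j))

theorem ω_le_ωsum (i : Fin n) : D.ω i ≤ D.ωsum :=
  Finset.single_le_sum (fun _ _ => Nat.zero_le _) (Finset.mem_univ i)

theorem chartInv_eq {ξ : Fin n → ℂ} {w : WedgeW D.ω} {A : Matrix (Fin n) (Fin n) ℂ}
    (hA : D.chart ξ w = evalForm D.ω ξ w • A) :
    D.chartInv ξ w = evalForm D.ω ξ w ^ (D.ωsum * n) • wedgeMap D.ω A D.pn := by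
  have h : ∀ j, rowScale D.ω (fun i => evalForm D.ω ξ w ^ (D.ωsum - D.ω i))
      (symWMap D.ω (D.chart ξ w) (D.col j)) =
      evalForm D.ω ξ w ^ D.ωsum • symWMap D.ω A (D.col j) := by
    intro j
    rw [hA, symWMap_smul]
    funext i
    simp only [rowScale, LinearMap.pi_apply, LinearMap.smul_apply, LinearMap.proj_apply, smul_smul,
      Pi.smul_apply, ← pow_add, Nat.sub_add_cancel (D.ω_le_ωsum i)]
  rw [chartInv, wedgeMap_pn]
  simp only [h]
  refine ((exteriorPower.ιMulti ℂ n (M := SymW D.ω)).toMultilinearMap.map_smul_univ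
    (fun _ => evalForm D.ω ξ w ^ D.ωsum) fun j => symWMap D.ω A (D.col j)).trans ?_
  rw [Finset.prod_const, Finset.card_univ, Fintype.card_fin, ← pow_mul]
  rfl

theorem chartInv_smul (ξ : Fin n → ℂ) (c : ℂ) (w : WedgeW D.ω) :
    D.chartInv ξ (c • w) = c ^ (D.ωsum * n) • D.chartInv ξ w := by
  have h : ∀ j, rowScale D.ω (fun i => evalForm D.ω ξ (c • w) ^ (D.ωsum - D.ω i))
      (symWMap D.ω (D.chart ξ (c • w)) (D.col j)) =
      c ^ D.ωsum • rowScale D.ω (fun i => evalForm D.ω ξ w ^ (D.ωsum - D.ω i))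
        (symWMap D.ω (D.chart ξ w) (D.col j)) := by
    intro j
    rw [chart_smul, symWMap_smul]
    funext i
    have hc : c ^ D.ωsum = c ^ (D.ωsum - D.ω i) * c ^ D.ω i := by
      rw [← pow_add, Nat.sub_add_cancel (D.ω_le_ωsum i)]
    simp only [rowScale, LinearMap.pi_apply, LinearMap.smul_apply, LinearMap.proj_apply, smul_smul,
      Pi.smul_apply, map_smul, smul_eq_mul, mul_pow, hc]
    congr 1
    ring
  rw [chartInv]
  simp only [h]
  refine ((exteriorPower.ιMulti ℂ n (M := SymW D.ω)).toMultilinearMap.map_smul_univ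
    (fun _ => c ^ D.ωsum) _).trans ?_
  rw [Finset.prod_const, Finset.card_univ, Fintype.card_fin, ← pow_mul]
  rfl

theorem isPolyMap_chartInv (ξ : Fin n → ℂ) : IsPolyMap (D.chartInv ξ) := by
  have hy : IsPolyFun fun w => evalForm D.ω ξ w := IsPolyFun.linear _
  have hA : ∀ s j, IsPolyFun fun w => D.chart ξ w s j := fun s j => IsPolyFun.linear
    (detForm fun i => if i = j then coeffAt D.ω s 0 else evalAt D.ω ξ i)
  refine isPolyMap_ιMulti D.ω (G := fun j w => rowScale D.ω
    (fun i => evalForm D.ω ξ w ^ (D.ωsum - D.ω i)) (symWMap D.ω (D.chart ξ w) (D.col j)))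
    fun j i => ?_
  exact (isPolyMap_symWMap D.ω hA (D.col j) i).smul (hy.pow _)

/-- A point of the closure of `GL(n)/Û` at which some `evalForm ξ` does not vanish is of the form
`[A 𝔭_n]` for a, possibly singular, matrix `A`. -/
theorem exists_rep_eq_of_evalForm_ne_zero {x : ℙ ℂ (WedgeW D.ω)} (hx : x ∈ D.orbitClosure)
    {ξ : Fin n → ℂ} (hξ : evalForm D.ω ξ x.rep ≠ 0) :
    ∃ (A : Matrix (Fin n) (Fin n) ℂ) (c : ℂ), x.rep = c • wedgeMap D.ω A D.pn := by
  have hpos : 0 < D.ωsum := (Nat.zero_le n).trans_lt D.n_lt_ωsum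
  -- The relation `y ^ (n |ω|) • w = y • chartInv w` is homogeneous and holds on the orbit.
  have key : evalForm D.ω ξ x.rep ^ (D.ωsum * n) • x.rep =
      evalForm D.ω ξ x.rep • D.chartInv ξ x.rep := by
    rw [← sub_eq_zero, ← Module.forall_dual_apply_eq_zero_iff ℂ]
    intro l
    refine hx (D.ωsum * n + 1) (fun w => l (evalForm D.ω ξ w ^ (D.ωsum * n) • w -
      evalForm D.ω ξ w • D.chartInv ξ w)) ?_ (fun c w => ?_) fun s hs => ?_
    · simp only [map_sub, map_smul, smul_eq_mul]
      have hy : IsPolyFun fun w => evalForm D.ω ξ w := IsPolyFun.linear _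
      exact ((hy.pow _).mul (IsPolyFun.linear l)).sub (hy.mul (D.isPolyMap_chartInv ξ l))
    · simp only [map_sub, map_smul, smul_eq_mul, chartInv_smul]
      ring
    · obtain ⟨g, c, hg⟩ := D.exists_rep_eq hs
      by_cases h0 : (ξ ᵥ* (g : Matrix (Fin n) (Fin n) ℂ)) 0 = 0
      · have hy : evalForm D.ω ξ s.rep = 0 := by
          rw [hg, map_smul, D.evalForm_wedgeMap_pn, h0, zero_pow hpos.ne', smul_zero]
        simp [hy, hpos.ne', NeZero.ne n]
      · obtain ⟨A, c', hA, hgA⟩ := D.exists_normalised ξ g h0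
        have hw : s.rep = (c * c') • wedgeMap D.ω A D.pn := by rw [hg, hgA, smul_smul]
        have hy : evalForm D.ω ξ s.rep = c * c' := by
          rw [hw, map_smul, D.evalForm_wedgeMap_pn, hA]
          simp
        have hch : D.chart ξ s.rep = evalForm D.ω ξ s.rep • A := by
          rw [hy, hw, chart_smul, D.chart_wedgeMap_pn hA]
        rw [D.chartInv_eq hch, hy, hw, smul_smul, smul_smul, ← pow_succ, ← pow_succ', sub_self,
          map_zero]
  have hch : D.chart ξ x.rep =
      evalForm D.ω ξ x.rep • ((evalForm D.ω ξ x.rep)⁻¹ • D.chart ξ x.rep) := by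
    rw [smul_smul, mul_inv_cancel₀ hξ, one_smul]
  rw [D.chartInv_eq hch, smul_comm] at key
  exact ⟨_, _, smul_right_injective _ (pow_ne_zero _ hξ) key⟩

end FirstRowGroup

/-! ### Destabilising one-parameter subgroups -/

/-- A singular matrix `A` is multiplied by `t` by a one-parameter subgroup of `SL(n)`: it acts by `t`
on a hyperplane containing the image of `A`. -/
theorem exists_oneParameter_mul_eq_smul {n : ℕ} {A : Matrix (Fin n) (Fin n) ℂ} (hA : A.det = 0) :
    ∃ (g : ℂˣ → SL(n, ℂ)) (e : Fin n × Fin n → ℂ → ℂ), (∀ ij, IsPolyFun (e ij)) ∧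
      (∀ (t : ℂˣ) ij, (t : ℂ) ^ n * g t ij.1 ij.2 = e ij t) ∧
      ∀ t : ℂˣ, (g t : Matrix (Fin n) (Fin n) ℂ) * A = (t : ℂ) • A := by
  obtain ⟨η, hη, hηA⟩ := Matrix.exists_vecMul_eq_zero_iff.2 hA
  obtain ⟨s, hs⟩ := Function.ne_iff.1 hη
  let u : Fin n → ℂ := Pi.single s (η s)⁻¹
  have hu : η ⬝ᵥ u = 1 := by rw [dotProduct_single, mul_inv_cancel₀ hs]
  let M : ℂˣ → Matrix (Fin n) (Fin n) ℂ := fun t =>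
    (t : ℂ) • (1 + vecMulVec (((t : ℂ)⁻¹ ^ n - 1) • u) η)
  have hM : ∀ t, (M t).det = 1 := by
    intro t
    rw [det_smul, vecMulVec_eq Unit, det_one_add_replicateCol_mul_replicateRow, dotProduct_smul, hu,
      Fintype.card_fin, smul_eq_mul, mul_one, add_sub_cancel, ← mul_pow,
      mul_inv_cancel₀ t.ne_zero, one_pow]
  refine ⟨fun t => ⟨M t, hM t⟩, fun ij t => t ^ (n + 1) * ((1 : Matrix _ _ ℂ) ij.1 ij.2 -
    u ij.1 * η ij.2) + t * (u ij.1 * η ij.2), fun ij => ?_, fun t ij => ?_, fun t => ?_⟩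
  · exact ((IsPolyFun.id.pow _).mul (IsPolyFun.const _)).add (IsPolyFun.id.mul (IsPolyFun.const _))
  · have h : (t : ℂ) ^ n * (t : ℂ)⁻¹ ^ n = 1 := by
      rw [← mul_pow, mul_inv_cancel₀ t.ne_zero, one_pow]
    change (t : ℂ) ^ n * M t ij.1 ij.2 = _
    simp only [M, Matrix.smul_apply, Matrix.add_apply, vecMulVec_apply, Pi.smul_apply, smul_eq_mul]
    linear_combination ((t : ℂ) * (u ij.1 * η ij.2)) * h
  · change M t * A = _
    rw [Matrix.smul_mul, Matrix.add_mul, vecMulVec_mul, hηA, vecMulVec_zero, one_mul, add_zero]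

theorem p1Rep_apply {n : ℕ} (g : SL(n, ℂ)) (t : ℂˣ) (z : Fin 2 → ℂ) :
    p1Rep n (g, t⁻¹) z = ![(t : ℂ) * z 0, z 1] := by
  change Matrix.toLin' (Matrix.diagonal ![((t⁻¹⁻¹ : ℂˣ) : ℂ), 1]) z = _
  funext i
  fin_cases i <;> simp [mulVec_diagonal]

namespace FirstRowGroup

variable {n : ℕ} [NeZero n] (D : FirstRowGroup n)

theorem wRep_apply_one (g : SL(n, ℂ)) (w : WedgeW D.ω) :
    D.wRep (g, 1) w = wedgeMap D.ω (g : Matrix (Fin n) (Fin n) ℂ) w := by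
  change (((1 : ℂˣ) ^ (-((n * D.ωsum : ℕ) : ℤ)) : ℂˣ) : ℂ) • wedgeRep D.ω (_ * _) w = _
  rw [one_pow, map_one, mul_one, _root_.one_zpow, Units.val_one, one_smul]
  rfl

theorem wRep_apply_inv (g : SL(n, ℂ)) (t : ℂˣ) (w : WedgeW D.ω) :
    D.wRep (g, t⁻¹) w = (t : ℂ) ^ (n * D.ωsum) •
      wedgeMap D.ω (g : Matrix (Fin n) (Fin n) ℂ)
        (wedgeMap D.ω (((t : ℂ)⁻¹ ^ D.ωsum) • 1) w) := by
  change (((t⁻¹) ^ (-((n * D.ωsum : ℕ) : ℤ)) : ℂˣ) : ℂ) • wedgeRep D.ω (_ * _) w = _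
  rw [_root_.inv_zpow', neg_neg, zpow_natCast, Units.val_pow_eq_pow_val, ← wedgeMap_mul,
    wedgeRep_apply, Units.val_mul, coe_scalar]
  simp

/-- The curve through which a one-parameter subgroup multiplying `A` by `t` moves `A 𝔭_n`, divided by
`t ^ n`. -/
theorem exists_wedgeMap_smul_curve (A : Matrix (Fin n) (Fin n) ℂ) :
    ∃ γ : ℂ → WedgeW D.ω, IsPolyMap γ ∧
      ∀ t : ℂ, wedgeMap D.ω (t • A) D.pn = t ^ n • γ t := by
  refine ⟨fun t => exteriorPower.ιMulti ℂ n fun j =>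
    rowScale D.ω (fun i => t ^ (D.ω i - 1)) (symWMap D.ω A (D.col j)), ?_, fun t => ?_⟩
  · refine isPolyMap_ιMulti D.ω (G := fun j t => rowScale D.ω (fun i => t ^ (D.ω i - 1))
      (symWMap D.ω A (D.col j))) fun j i => ?_
    exact (IsPolyMap.const (symWMap D.ω A (D.col j) i)).smul (IsPolyFun.id.pow _)
  · have h : ∀ j, symWMap D.ω (t • A) (D.col j) =
        t • rowScale D.ω (fun i => t ^ (D.ω i - 1)) (symWMap D.ω A (D.col j)) := by
      intro j
      rw [symWMap_smul]
      funext i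
      simp only [rowScale, LinearMap.pi_apply, LinearMap.smul_apply, LinearMap.proj_apply,
        smul_smul, Pi.smul_apply, ← pow_succ', Nat.sub_add_cancel (D.ω_pos i)]
    rw [wedgeMap_pn]
    simp only [h]
    refine ((exteriorPower.ιMulti ℂ n (M := SymW D.ω)).toMultilinearMap.map_smul_univ
      (fun _ => t) _).trans ?_
    rw [Finset.prod_const, Finset.card_univ, Fintype.card_fin]
    rfl

/-- The lower bound on well adapted characters, cleared of denominators. The subtraction is not
truncated, by `n_le_ωsecond`. -/
theorem lt_of_wellAdapted {χ : ℤ} {p : ℕ} (hp : 0 < p) (h : D.WellAdapted χ p) :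
    (((D.ωsecond - n) * D.ωsum * p : ℕ) : ℤ) < χ := by
  have hω : 0 < D.ωsum := (Nat.zero_le n).trans_lt D.n_lt_ωsum
  have h₁ := h.1
  rw [lt_div_iff₀ (by positivity)] at h₁
  have h₂ : (((D.ωsecond - n) * D.ωsum * p : ℕ) : ℚ) < χ := by
    rw [Nat.cast_mul, Nat.cast_mul, Nat.cast_sub D.n_le_ωsecond]
    linarith
  exact_mod_cast h₂

variable {V : Type*} [AddCommGroup V] [Module ℂ V]
  {ρ : Representation ℂ SL(n, ℂ) V}

/-- Points `[A 𝔭_n]` with `A` singular are destabilised by a one-parameter subgroup of `SL(n)` acting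
with positive weights on `A 𝔭_n`. -/
theorem eq_zero_of_det_eq_zero {d : ℕ} (hd : HasPoleBound ρ d)
    {p q r m : ℕ} (hm : 0 < m) (hpq : d * q < p) {f : WedgeW D.ω × V × (Fin 2 → ℂ) → ℂ}
    (hf : IsPolyFun f)
    (hhom : ∀ (a b c : ℂ) (u : WedgeW D.ω) (v : V) (z : Fin 2 → ℂ),
      f (a • u, b • v, c • z) = a ^ (m * p) * b ^ (m * q) * c ^ (m * r) * f (u, v, z))
    {w : WedgeW D.ω} {v : V} {z : Fin 2 → ℂ} {θ : SL(n, ℂ) × ℂˣ →* ℂˣ}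
    (hθ : ∀ g, θ (g, 1) = 1)
    (hinv : ∀ g, f (D.wRep g w, xRep ρ g v, p1Rep n g z) = ((θ g : ℂˣ) : ℂ) ^ m * f (w, v, z))
    {A : Matrix (Fin n) (Fin n) ℂ} {c : ℂ} (hw : w = c • wedgeMap D.ω A D.pn) (hA : A.det = 0) :
    f (w, v, z) = 0 := by
  obtain ⟨g, e, he, hge, hgA⟩ := exists_oneParameter_mul_eq_smul hA
  obtain ⟨γV, hγV, hγVg⟩ := hd n g e he hge v
  obtain ⟨γW, hγW, hγWA⟩ := D.exists_wedgeMap_smul_curve A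
  -- The factor `t ^ n` split off on `⋀ⁿ Sym^ω ℂⁿ` gives the order `n m p`, of which the pole of order
  -- at most `n d` on `V` takes away at most `n m d q`.
  have hk : 0 < n * m * (p - d * q) :=
    Nat.mul_pos (Nat.mul_pos (NeZero.pos n) hm) (Nat.sub_pos_of_lt hpq)
  refine eq_zero_of_pow_mul_eq (h := fun t => f (c • γW t, γV t, z)) ?_ hk fun t => ?_
  · exact hf.comp ((hγW.smul (IsPolyFun.const c)).prodMk (hγV.prodMk (IsPolyMap.const z)))
  · have h := hinv (g t, 1)
    have h₁ : D.wRep (g t, 1) w = (t : ℂ) ^ n • c • γW t := by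
      rw [wRep_apply_one, hw, map_smul, ← wedgeMap_mul, hgA, hγWA, smul_comm]
    have h₂ : p1Rep n (g t, 1) z = z := by
      have := p1Rep_apply (g t) 1 z
      rw [inv_one] at this
      rw [this]
      funext i
      fin_cases i <;> simp
    have h₃ := hhom ((t : ℂ) ^ n) 1 1 (c • γW t) (ρ (g t) v) z
    have h₄ := hhom 1 ((t : ℂ) ^ (n * d)) 1 (c • γW t) (ρ (g t) v) z
    rw [h₁, h₂, hθ, Units.val_one, one_pow, one_mul] at h
    rw [one_smul, one_smul, one_pow, one_pow, mul_one, mul_one] at h₃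
    rw [one_smul, one_smul, one_pow, one_pow, mul_one, one_mul, ← hγVg] at h₄
    change f ((t : ℂ) ^ n • c • γW t, ρ (g t) v, z) = _ at h
    rw [h₃] at h
    rw [h₄, ← h, ← mul_assoc, ← pow_mul, ← pow_mul, ← pow_add]
    congr 2
    obtain ⟨k, rfl⟩ := Nat.exists_eq_add_of_lt hpq
    rw [show d * q + k + 1 - d * q = k + 1 by omega]
    ring

/-- Points of the span of the orbit without component of weight `|ω|` are destabilised by the
central one-parameter subgroup, by the lower bound on well adapted characters. -/
theorem eq_zero_of_evalForm_eq_zero {p q r m : ℕ} {χ : ℤ} (hm : 0 < m) (hp : 0 < p)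
    (hχ : D.WellAdapted χ p) {f : WedgeW D.ω × V × (Fin 2 → ℂ) → ℂ} (hf : IsPolyFun f)
    (hhom : ∀ (a b c : ℂ) (u : WedgeW D.ω) (v : V) (z : Fin 2 → ℂ),
      f (a • u, b • v, c • z) = a ^ (m * p) * b ^ (m * q) * c ^ (m * r) * f (u, v, z))
    {w : WedgeW D.ω} {v : V} {z : Fin 2 → ℂ}
    (hinv : ∀ g, f (D.wRep g w, xRep ρ g v, p1Rep n g z) =
      ((twist n χ g : ℂˣ) : ℂ) ^ m * f (w, v, z))
    (hw : w ∈ D.orbitSpan) (hξ : ∀ ξ, evalForm D.ω ξ w = 0) : f (w, v, z) = 0 := by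
  obtain ⟨Q, hQ, hQw⟩ := D.exists_weight_decomposition hw hξ
  -- `b` is the largest weight that `ℂˣ` can have on `w`. The element `t⁻¹` acts on the component `Q i`
  -- by `t ^ (-(i - n) |ω|)`, so that `t ^ b` clears the denominators.
  set b := (D.ωsecond - n) * D.ωsum with hb
  obtain ⟨k, hk⟩ := Int.le.dest (Int.add_one_le_of_lt (D.lt_of_wellAdapted hp hχ))
  let γW : ℂ → WedgeW D.ω := fun t =>
    ∑ i ∈ Finset.range (D.ωsum + 1), t ^ ((D.ωsecond - i) * D.ωsum) • Q i
  let γZ : ℂ → Fin 2 → ℂ := fun t => ![t * z 0, z 1]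
  have hγW : IsPolyMap γW :=
    IsPolyMap.sum fun i _ => (IsPolyMap.const (Q i)).smul (IsPolyFun.id.pow _)
  have hγZ : IsPolyMap γZ := by
    have h : γZ = fun t => ∑ i : Fin 2, (![t, 1] i) • (Pi.single i (z i) : Fin 2 → ℂ) := by
      funext t i
      fin_cases i <;> simp [γZ, Fin.sum_univ_two]
    rw [h]
    refine IsPolyMap.sum fun i _ => (IsPolyMap.const _).smul ?_
    fin_cases i
    · exact IsPolyFun.id
    · exact IsPolyFun.const 1
  refine eq_zero_of_pow_mul_eq (h := fun t => f (γW t, v, γZ t)) ?_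
    (Nat.mul_pos k.succ_pos hm) fun t => ?_
  · exact hf.comp (hγW.prodMk ((IsPolyMap.const v).prodMk hγZ))
  · have ht : (t : ℂ) ≠ 0 := t.ne_zero
    have hγ : (t : ℂ) ^ b • D.wRep (1, t⁻¹) w = γW t := by
      rw [wRep_apply_inv]
      refine (congrArg (fun u => (t : ℂ) ^ b • (t : ℂ) ^ (n * D.ωsum) • u)
        (wedgeMap_one D.ω _)).trans ?_
      simp only [hQw, Finset.smul_sum]
      refine Finset.sum_congr rfl fun i _ => ?_
      rcases lt_or_ge D.ωsecond i with hi | hi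
      · simp [hQ i hi]
      · rw [smul_smul, smul_smul]
        congr 1
        have h₁ : b + n * D.ωsum = (D.ωsecond - i) * D.ωsum + D.ωsum * i := by
          rw [hb, ← add_mul, Nat.sub_add_cancel D.n_le_ωsecond, mul_comm D.ωsum i, ← add_mul,
            Nat.sub_add_cancel hi]
        rw [← pow_add, h₁, pow_add, ← pow_mul, inv_pow, mul_assoc,
          mul_inv_cancel₀ (pow_ne_zero _ ht), mul_one]
    have h := hinv (1, t⁻¹)
    have hθ : ((twist n χ (1, t⁻¹) : ℂˣ) : ℂ) = ((t : ℂ) ^ (b * p + (k + 1)))⁻¹ := by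
      have hχk : χ = ((b * p + (k + 1) : ℕ) : ℤ) := by
        rw [← hk, hb]; push_cast; ring
      change (((t⁻¹) ^ χ : ℂˣ) : ℂ) = _
      rw [hχk, zpow_natCast, Units.val_pow_eq_pow_val, Units.val_inv_eq_inv_val, inv_pow]
    have hρ : xRep ρ (1, t⁻¹) v = v := by
      change ρ 1 v = v
      rw [map_one]; rfl
    have h₁ := hhom ((t : ℂ) ^ b) 1 1 (D.wRep (1, t⁻¹) w) v (p1Rep n (1, t⁻¹) z)
    rw [one_smul, one_smul, one_pow, one_pow, mul_one, mul_one, hγ] at h₁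
    rw [hρ, hθ] at h
    rw [h, p1Rep_apply] at h₁
    rw [h₁, inv_pow, ← pow_mul, ← pow_mul, ← mul_assoc, ← mul_assoc, ← pow_add]
    have h₂ : (k + 1) * m + b * (m * p) = (b * p + (k + 1)) * m := by ring
    rw [h₂, mul_inv_cancel₀ (pow_ne_zero _ ht), one_mul]

/-- Points `([g 𝔭_n], v, ∞)` are destabilised by the one-parameter subgroup `(g s(t) g⁻¹, t⁻¹)`, which
fixes the vector `g 𝔭_n`: its weight on `∞` and `χ ≥ 0` outweigh its weights on `V`. -/
theorem eq_zero_of_mem_orbit {d : ℕ} (hd : HasPoleBound ρ d)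
    {p q r m : ℕ} {χ : ℤ} (hm : 0 < m) (hp : 0 < p) (hqr : n * D.ωsum * d * q < r)
    (hχ : D.WellAdapted χ p) {f : WedgeW D.ω × V × (Fin 2 → ℂ) → ℂ} (hf : IsPolyFun f)
    (hhom : ∀ (a b c : ℂ) (u : WedgeW D.ω) (v : V) (z : Fin 2 → ℂ),
      f (a • u, b • v, c • z) = a ^ (m * p) * b ^ (m * q) * c ^ (m * r) * f (u, v, z))
    {w : WedgeW D.ω} {v : V} {z : Fin 2 → ℂ}
    (hinv : ∀ g, f (D.wRep g w, xRep ρ g v, p1Rep n g z) =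
      ((twist n χ g : ℂˣ) : ℂ) ^ m * f (w, v, z))
    {g : GL (Fin n) ℂ} {c : ℂ} (hw : w = c • wedgeMap D.ω g D.pn) (hz : z 1 = 0) :
    f (w, v, z) = 0 := by
  -- `s(t) = diag(t ^ (|ω| - n ω_i))`, written as the product of a scalar and an element of `Û`.
  let s : ℂˣ → GL (Fin n) ℂ := fun t =>
    Matrix.GeneralLinearGroup.scalar (Fin n) (t ^ D.ωsum) * D.torus (t⁻¹ ^ n)
  have hs : ∀ t, (s t : Matrix (Fin n) (Fin n) ℂ) =
      Matrix.diagonal fun i => (t : ℂ) ^ D.ωsum * ((t : ℂ)⁻¹ ^ n) ^ D.ω i := by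
    intro t
    rw [Units.val_mul, coe_scalar, coe_torus, Matrix.smul_mul, one_mul, ← diagonal_smul]
    simp only [Units.val_pow_eq_pow_val, Units.val_inv_eq_inv_val]
    rfl
  have hdet : ∀ t, ((g * s t * g⁻¹ : GL (Fin n) ℂ) : Matrix (Fin n) (Fin n) ℂ).det = 1 := by
    intro t
    have hg : (g : Matrix (Fin n) (Fin n) ℂ).det *
        ((g⁻¹ : GL (Fin n) ℂ) : Matrix (Fin n) (Fin n) ℂ).det = 1 := by
      rw [← det_mul, ← Units.val_mul, mul_inv_cancel, Units.val_one, det_one]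
    have h : (s t : Matrix (Fin n) (Fin n) ℂ).det = 1 := by
      rw [hs, det_diagonal, Finset.prod_mul_distrib, Finset.prod_const, Finset.card_univ,
        Fintype.card_fin, Finset.prod_pow_eq_pow_sum, ← pow_mul, ← pow_mul, mul_comm, inv_pow,
        mul_comm n]
      exact inv_mul_cancel₀ (pow_ne_zero _ t.ne_zero)
    rw [Units.val_mul, Units.val_mul, det_mul, det_mul, h, mul_one, hg]
  let σ : ℂˣ → SL(n, ℂ) := fun t => ⟨_, hdet t⟩
  let e : Fin n × Fin n → ℂ → ℂ := fun ij t => ∑ k, g ij.1 k *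
    t ^ (n * D.ωsum - n * D.ω k + D.ωsum) * (g⁻¹ : GL (Fin n) ℂ) k ij.2
  obtain ⟨γV, hγV, hγVg⟩ := hd (n * D.ωsum) σ e
    (fun ij => IsPolyFun.sum fun k _ =>
      ((IsPolyFun.const _).mul (IsPolyFun.id.pow _)).mul (IsPolyFun.const _))
    (fun t ij => by
      have h : σ t ij.1 ij.2 = ∑ k, g ij.1 k * ((t : ℂ) ^ D.ωsum * ((t : ℂ)⁻¹ ^ n) ^ D.ω k) *
          (g⁻¹ : GL (Fin n) ℂ) k ij.2 := by
        change ((g * s t * g⁻¹ : GL (Fin n) ℂ) : Matrix (Fin n) (Fin n) ℂ) ij.1 ij.2 = _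
        rw [Units.val_mul, Units.val_mul, hs, mul_apply]
        simp only [mul_diagonal]
      rw [h, Finset.mul_sum]
      refine Finset.sum_congr rfl fun k _ => ?_
      have h₁ : (t : ℂ) ^ (n * D.ωsum) * ((t : ℂ)⁻¹ ^ n) ^ D.ω k =
          (t : ℂ) ^ (n * D.ωsum - n * D.ω k) := by
        rw [← pow_mul, inv_pow]
        exact (pow_sub₀ _ t.ne_zero (Nat.mul_le_mul_left n (D.ω_le_ωsum k))).symm
      rw [pow_add, ← h₁]
      ring) v
  obtain ⟨k, rfl⟩ : ∃ k : ℕ, χ = k :=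
    Int.eq_ofNat_of_zero_le ((Int.natCast_nonneg _).trans (D.lt_of_wellAdapted hp hχ).le)
  have hk : 0 < (k + (r - n * D.ωsum * d * q)) * m :=
    Nat.mul_pos (Nat.add_pos_right _ (Nat.sub_pos_of_lt hqr)) hm
  refine eq_zero_of_pow_mul_eq (h := fun t => f (w, γV t, z)) ?_ hk fun t => ?_
  · exact hf.comp ((IsPolyMap.const w).prodMk (hγV.prodMk (IsPolyMap.const z)))
  · have ht : (t : ℂ) ≠ 0 := t.ne_zero
    have h₁ : D.wRep (σ t, t⁻¹) w = w := by
      have hst : (σ t : Matrix (Fin n) (Fin n) ℂ) * (((t : ℂ)⁻¹ ^ D.ωsum) • 1) * g =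
          g * D.torus (t⁻¹ ^ n) := by
        change ((g * s t * g⁻¹ : GL (Fin n) ℂ) : Matrix (Fin n) (Fin n) ℂ) * _ * _ = _
        rw [Matrix.mul_smul, mul_one, Matrix.smul_mul, ← Units.val_mul, inv_mul_cancel_right,
          Units.val_mul, Units.val_mul, coe_scalar, Matrix.smul_mul, one_mul, Matrix.mul_smul,
          smul_smul, Units.val_pow_eq_pow_val, ← mul_pow, inv_mul_cancel₀ ht, one_pow, one_smul]
      rw [wRep_apply_inv, hw, map_smul, map_smul, ← wedgeMap_mul, ← wedgeMap_mul, hst,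
        wedgeMap_mul, wedgeMap_torus_pn, map_smul, smul_comm c, smul_smul,
        Units.val_pow_eq_pow_val, Units.val_inv_eq_inv_val, ← pow_mul, inv_pow,
        mul_inv_cancel₀ (pow_ne_zero _ ht), one_smul]
    have h₂ : p1Rep n (σ t, t⁻¹) z = (t : ℂ) • z := by
      rw [p1Rep_apply]
      funext i
      fin_cases i <;> simp [hz]
    have hθ : ((twist n k (σ t, t⁻¹) : ℂˣ) : ℂ) = ((t : ℂ) ^ k)⁻¹ := by
      change (((t⁻¹) ^ (k : ℤ) : ℂˣ) : ℂ) = _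
      rw [zpow_natCast, Units.val_pow_eq_pow_val, Units.val_inv_eq_inv_val, inv_pow]
    have h := hinv (σ t, t⁻¹)
    rw [h₁, h₂, hθ] at h
    change f (w, ρ (σ t) v, (t : ℂ) • z) = _ at h
    have h₃ := hhom 1 1 t w (ρ (σ t) v) z
    have h₄ := hhom 1 ((t : ℂ) ^ (n * D.ωsum * d)) 1 w (ρ (σ t) v) z
    rw [one_smul, one_smul, one_pow, one_pow, one_mul, one_mul] at h₃
    rw [one_smul, one_smul, one_pow, one_pow, mul_one, one_mul, ← hγVg] at h₄
    rw [h₃] at h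
    have h₅ : (k + (r - n * D.ωsum * d * q)) * m + n * D.ωsum * d * (m * q) =
        k * m + m * r := by
      obtain ⟨l, hl⟩ := Nat.exists_eq_add_of_lt hqr
      rw [show r - n * D.ωsum * d * q = l + 1 by omega, hl]
      ring
    rw [h₄, ← pow_mul, ← mul_assoc, ← pow_add, h₅, pow_add, mul_assoc, h, ← mul_assoc, inv_pow,
      ← pow_mul, mul_inv_cancel₀ (pow_ne_zero _ ht), one_mul]

/-- The part of the boundary over the boundary of `GL(n)/Û` is unstable, with respect to any
`𝒪(p) ⊗ 𝒪(q) ⊗ 𝒪(r)` with `p` large compared to `q`, including `r = 0`. -/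
theorem exists_not_isSemistable₃_of_notMem_orbit [FiniteDimensional ℂ V]
    (hρ : IsAlgebraicRep ρ) (X : Set (ℙ ℂ V)) :
    ∃ C : ℕ, ∀ (p q r : ℕ) (χ : ℤ), C * q < p → D.WellAdapted χ p →
      ∀ x ∈ D.completion₃ X, x.1 ∉ D.orbit →
        ¬ IsSemistable₃ D.wRep (xRep ρ) (p1Rep n) p q r (twist n χ) (D.completion₃ X) x := by
  obtain ⟨d, hd⟩ := hρ.exists_hasPoleBound
  refine ⟨d, fun p q r χ hpq hχ x hx hxo ⟨m, f, hm, hf, hhom, hinv, hne⟩ => hne ?_⟩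
  by_cases hξ : ∀ ξ, evalForm D.ω ξ x.1.rep = 0
  · exact D.eq_zero_of_evalForm_eq_zero hm ((Nat.zero_le _).trans_lt hpq) hχ hf hhom
      (fun g => hinv g x hx) (D.rep_mem_orbitSpan hx.1) hξ
  · obtain ⟨ξ, hξ⟩ := not_forall.1 hξ
    obtain ⟨A, c, hA⟩ := D.exists_rep_eq_of_evalForm_ne_zero hx.1 hξ
    refine D.eq_zero_of_det_eq_zero hd hm hpq hf hhom (fun g => ?_) (fun g => hinv g x hx) hA ?_
    · exact one_zpow χ
    · by_contra hdet
      exact hxo (D.mem_orbit_of_rep_eq (g := Matrix.GeneralLinearGroup.mkOfDetNeZero A hdet) hA)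

/-- The part of the boundary over `∞ ∈ ℙ¹` and over `GL(n)/Û` is unstable. -/
theorem exists_not_isSemistable₃_of_mem_orbit [FiniteDimensional ℂ V]
    (hρ : IsAlgebraicRep ρ) (X : Set (ℙ ℂ V)) :
    ∃ C : ℕ, ∀ (p q r : ℕ) (χ : ℤ), 0 < p → C * q < r → D.WellAdapted χ p →
      ∀ x ∈ D.completion₃ X, x.1 ∈ D.orbit → x.2.2 ∉ affineLine →
        ¬ IsSemistable₃ D.wRep (xRep ρ) (p1Rep n) p q r (twist n χ) (D.completion₃ X) x := by
  obtain ⟨d, hd⟩ := hρ.exists_hasPoleBound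
  refine ⟨n * D.ωsum * d, fun p q r χ hp hqr hχ x hx hxo hz
    ⟨m, f, hm, hf, hhom, hinv, hne⟩ => hne ?_⟩
  obtain ⟨g, c, hg⟩ := D.exists_rep_eq hxo
  exact D.eq_zero_of_mem_orbit hd hm hp hqr hχ hf hhom (fun g => hinv g x hx) hg (not_not.1 hz)

/-- A semistable point for `𝒪(p) ⊗ 𝒪(q)` gives semistable points for `𝒪(p) ⊗ 𝒪(q) ⊗ 𝒪(0)`. -/
theorem isSemistable₃_of_isSemistable₂ {X : Set (ℙ ℂ V)} {p q : ℕ} {χ : ℤ}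
    {x : ℙ ℂ (WedgeW D.ω) × ℙ ℂ V}
    (h : IsSemistable₂ D.wRep (xRep ρ) p q (twist n χ) (D.completion₂ X) x)
    (z : ℙ ℂ (Fin 2 → ℂ)) :
    IsSemistable₃ D.wRep (xRep ρ) (p1Rep n) p q 0 (twist n χ) (D.completion₃ X)
      (x.1, x.2, z) := by
  obtain ⟨m, f, hm, hf, hhom, hinv, hne⟩ := h
  refine ⟨m, fun y => f (y.1, y.2.1), hm, ?_, fun a b c u v _ => ?_, fun g y hy => ?_, hne⟩
  · exact hf.comp (G := fun y : WedgeW D.ω × V × (Fin 2 → ℂ) => (y.1, y.2.1))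
      fun l => IsPolyFun.linear
        (l ∘ₗ LinearMap.prodMap LinearMap.id (LinearMap.fst ℂ V (Fin 2 → ℂ)))
  · simp only [hhom, mul_zero, pow_zero, mul_one]
  · exact hinv g (y.1, y.2.1) ⟨hy.1, hy.2.1⟩

end FirstRowGroup

end GradedGIT
end

theorem mainTheorem9 {n : ℕ} [NeZero n] (D : GradedGIT.FirstRowGroup n)
    {V : Type*} [AddCommGroup V] [Module ℂ V] [FiniteDimensional ℂ V]
    (ρ : Representation ℂ SL(n, ℂ) V) (hρ : GradedGIT.IsAlgebraicRep ρ)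
    (X : Set (ℙ ℂ V)) (hX : GradedGIT.IsZariskiClosed X)
    (hXinv : ∀ g : SL(n, ℂ), ∀ x ∈ X, GradedGIT.projAct ρ g x ∈ X) :
    (∃ C : ℕ, ∀ (p q : ℕ) (χ : ℤ), 0 < q → C * q < p → D.WellAdapted χ p →
      ∀ x ∈ D.boundary₂ X,
        ¬ GradedGIT.IsSemistable₂ D.wRep (GradedGIT.xRep ρ) p q (GradedGIT.twist n χ) (D.completion₂ X) x) ∧
    (∃ C : ℕ, ∀ (p q r : ℕ) (χ : ℤ), 0 < q → C * q < p → C * q < r → D.WellAdapted χ p →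
      ∀ x ∈ D.boundary₃ X,
        ¬ GradedGIT.IsSemistable₃ D.wRep (GradedGIT.xRep ρ) (GradedGIT.p1Rep n) p q r (GradedGIT.twist n χ) (D.completion₃ X) x) := by
  obtain ⟨C₁, h₁⟩ := D.exists_not_isSemistable₃_of_notMem_orbit hρ X
  obtain ⟨C₂, h₂⟩ := D.exists_not_isSemistable₃_of_mem_orbit hρ X
  refine ⟨⟨C₁, fun p q χ _ hpq hχ x hx hss => ?_⟩,
    ⟨C₁ + C₂, fun p q r χ _ hpq hqr hχ x hx => ?_⟩⟩
  · have hxX : x.2 ∈ X := hx.1.2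
    let z : ℙ ℂ (Fin 2 → ℂ) := Projectivization.mk ℂ 1 one_ne_zero
    exact h₁ p q 0 χ hpq hχ (x.1, x.2, z) ⟨hx.1.1, hxX, trivial⟩ (fun ho => hx.2 ⟨ho, hxX⟩)
      (D.isSemistable₃_of_isSemistable₂ hss z)
  · by_cases ho : x.1 ∈ D.orbit
    -- Over the orbit, the only boundary points are those over `∞ ∈ ℙ¹`.
    · exact h₂ p q r χ ((Nat.zero_le _).trans_lt hpq)
        ((Nat.mul_le_mul_right q (Nat.le_add_left _ _)).trans_lt hqr) hχ x hx.1 ho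
        fun hz => hx.2 ⟨ho, hx.1.2.1, hz⟩
    · exact h₁ p q r χ ((Nat.mul_le_mul_right q (Nat.le_add_right _ _)).trans_lt hpq) hχ x hx.1 ho
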